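/- Let $p$ be a prime and let $(A,\mathfrak m)$ be a Noetherian local ring which is $p$-torsion free with $p\in\mathfrak m$. Let $\phi\colon A\to A$ be a finite ring homomorphism with $\phi(a)\equiv a^p \pmod p$ for all $a\in A$ (a finite Frobenius lift), and let $\Delta(a):=(a^p-\phi(a))/p$. Write $\overline R:=R/pR$ for a ring $R$, and let $F^i_*$ denote restriction of scalars along the $i$-th iterate of Frobenius. Let $f\in A$. For $n\ge 0$ and integers $0\le l_0,\dots,l_{n-1}\le p-1$, $0\le l_n\le p$, let $Q_f(l_0,\dots,l_n)$ be the quotient of the $\overline A$-module $\bigoplus_{i=0}^{n}F^i_*(\overline{A/f^p})$ by the submodule of all elements $$\bigl(a_0f^{l_0},\ -a_0^p\Delta(f)^{l_0}+a_1f^{l_1},\ \dots,\ -a_{n-1}^p\Delta(f)^{l_{n-1}}+a_nf^{l_n}\bigr),\qquad a_0,\dots,a_n\in\overline A,$$ and let $\Phi_f(l_0,\dots,l_n)\colon \overline{A/f^{\,l_0+1}}\to Q_f(l_0,\dots,l_n)$ be the $\overline A$-linear map $a\mapsto(a,0,\dots,0)$. An $\overline A$-linear map is called pure if it stays injective after tensoring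 with every $\overline A$-module. The splitting-order sequence $(s_n)_{n\ge0}$ of $f$ is defined inductively: $s_0=0$; if $s_i=p$ for some $i<n$, then $s_n=p$; otherwise, for $n\ge1$, $$s_n=\max\{\,0\le s\le p : \Phi_f(s_0,\dots,s_{n-1},s)\text{ is not pure}\,\},$$ where $\max\varnothing:=0$ (the set is empty only if $f$ is a unit). For a ring $S$ and $n\ge1$, the Witt vector Frobenius induces a ring homomorphism $\Phi_{S,n}\colon\overline S\to W_n(S)/pW_n(S)$, sending the class of $a$ to the class of the Teichmüller element $[a^p]$. The ring $S$ is $n$-quasi-$F$-split if $\Phi_{S,n}$ splits as a homomorphism of $\overline S$-modules, where $\overline S$ acts on the target through $\Phi_{S,n}$; it is quasi-$F$-split of height $h$ if $h$ is the least integer $n\ge1$ for which it is $n$-quasi-$F$-split. Then, for every integer $h\ge1$, the ring $A/f$ is quasi-$F$-split of height $h$ if and only if $s_1=\dots=s_{h-1}=1$ and $s_h=0$. -/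

import Mathlib

noncomputable section

namespace QFSplit

universe u

/-- `R` is `p`-torsion free. -/
def IsPTorsionFree (p : ℕ) (R : Type u) [CommRing R] : Prop :=
  ∀ a : R, (p : R) * a = 0 → a = 0

/-- A ring endomorphism `φ` with `φ(a) ≡ a ^ p` modulo `p` for all `a`. -/
def IsFrobeniusLift (p : ℕ) {A : Type u} [CommRing A] (φ : A →+* A) : Prop :=
  ∀ a : A, (p : A) ∣ φ a - a ^ p

theorem IsFrobeniusLift.dvd {p : ℕ} {A : Type u} [CommRing A] {φ : A →+* A}
    (hφ : IsFrobeniusLift p φ) (a : A) : (p : A) ∣ a ^ p - φ a :=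
  (dvd_sub_comm).1 (hφ a)

/-- `Δ(a) = (a ^ p - φ(a)) / p`, the negative of the `δ`-structure attached to the Frobenius lift
`φ`: an element with `p * Δ(a) = a ^ p - φ(a)`, unique when the ring is `p`-torsion free. -/
def Delta {p : ℕ} {A : Type u} [CommRing A] {φ : A →+* A} (hφ : IsFrobeniusLift p φ) (a : A) : A :=
  (hφ.dvd a).choose

theorem p_mul_Delta {p : ℕ} {A : Type u} [CommRing A] {φ : A →+* A} (hφ : IsFrobeniusLift p φ)
    (a : A) : (p : A) * Delta hφ a = a ^ p - φ a :=
  (hφ.dvd a).choose_spec.symm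

/-- A homomorphism of `R`-modules `g : M → N` is pure if `P ⊗ M → P ⊗ N` is injective for every
`R`-module `P`. -/
def IsPure {R : Type u} [CommRing R] {M N : Type u} [AddCommGroup M] [Module R M]
    [AddCommGroup N] [Module R N] (g : M →ₗ[R] N) : Prop :=
  ∀ (P : Type u) [AddCommGroup P] [Module R P], Function.Injective (g.lTensor P)

/-- The reduction `R / pR`. -/
abbrev ModP (p : ℕ) (R : Type u) [CommRing R] : Type u := R ⧸ Ideal.span {(p : R)}

/-- The class in `R / pR` of an element of `R`. -/
abbrev toModP (p : ℕ) {R : Type u} [CommRing R] : R →+* ModP p R :=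
  Ideal.Quotient.mk (Ideal.span {(p : R)})

theorem natCast_modP (p : ℕ) (R : Type u) [CommRing R] : (p : ModP p R) = 0 := by
  have h : toModP p (p : R) = 0 :=
    Ideal.Quotient.eq_zero_iff_mem.2 (Ideal.mem_span_singleton_self _)
  simpa using h

/-! ### Quasi-F-splitting -/

section QuasiFSplit

variable (p : ℕ) [hp : Fact p.Prime] (S : Type u) [CommRing S]

/-- `W_n(S) / p W_n(S)`. -/
abbrev WnBar (n : ℕ) : Type u := ModP p (TruncatedWittVector p n S)

/-- The Witt vector Frobenius followed by the projection `W(S) → W_n(S) / p`. -/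
def frobWnBar (n : ℕ) : WittVector p S →+* WnBar p S n :=
  ((toModP p).comp (WittVector.truncate n)).comp WittVector.frobenius

/-- The Witt vector Frobenius induces a ring homomorphism `S = W(S) / V W(S) → W_n(S) / p`, because
`F V = p`. It sends `a` to the class of `F [a] = [a ^ p]`. -/
def PhiAux (n : ℕ) : S →+* WnBar p S n :=
  RingHom.liftOfRightInverse (WittVector.constantCoeff : WittVector p S →+* S)
    (WittVector.teichmuller p) (fun a => WittVector.teichmuller_coeff_zero p a)
    ⟨frobWnBar p S n, by
      intro x hx
      have hx0 : x.coeff 0 = 0 := hx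
      have h1 : WittVector.verschiebung (x.shift 1) = x := by
        refine (WittVector.verschiebung_shift x 0 (fun i hi => ?_)).trans ?_
        · have : i = 0 := by omega
          rw [this]
          exact hx0
        · ext i
          rw [WittVector.shift_coeff, zero_add]
      rw [RingHom.mem_ker, ← h1]
      simp only [frobWnBar, RingHom.comp_apply, WittVector.frobenius_verschiebung, map_mul,
        map_natCast]
      rw [natCast_modP, mul_zero]⟩

/-- The ring homomorphism `Φ_{S,n} : S / p → W_n(S) / p` induced by the Witt vector Frobenius;
it sends the class of `a` to the class of `[a ^ p]`. -/
def Phi (n : ℕ) : ModP p S →+* WnBar p S n :=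
  Ideal.Quotient.lift _ (PhiAux p S n) (by
    intro a ha
    obtain ⟨b, rfl⟩ := Ideal.mem_span_singleton.1 ha
    rw [map_mul, map_natCast, natCast_modP, zero_mul])

theorem Phi_apply (n : ℕ) (a : S) :
    Phi p S n (toModP p a) =
      toModP p (WittVector.truncate n
        (WittVector.frobenius (WittVector.teichmuller p a))) := by
  have h1 : Phi p S n (toModP p a) = PhiAux p S n a := Ideal.Quotient.lift_mk _ _ _
  have h2 : PhiAux p S n ((WittVector.constantCoeff : WittVector p S →+* S)
      (WittVector.teichmuller p a)) = frobWnBar p S n (WittVector.teichmuller p a) :=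
    RingHom.liftOfRightInverse_comp_apply _ _ _ _ _
  have h3 : (WittVector.constantCoeff : WittVector p S →+* S) (WittVector.teichmuller p a) = a :=
    WittVector.teichmuller_coeff_zero p a
  rw [h3] at h2
  rw [h1, h2]
  rfl

/-- `S` is `n`-quasi-`F`-split: `Φ_{S,n} : S / p → F_* (W_n(S) / p)` splits as a homomorphism of
`S / p`-modules, where `S / p` acts on the target through `Φ_{S,n}`. -/
def IsNQuasiFSplit (n : ℕ) : Prop :=
  letI : Module (ModP p S) (WnBar p S n) := (Phi p S n).toModule
  ∃ ψ : WnBar p S n →ₗ[ModP p S] ModP p S, ∀ a : ModP p S, ψ (Phi p S n a) = a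

/-- `S` is quasi-`F`-split of height `h`: `h` is the least positive `n` for which `S` is
`n`-quasi-`F`-split. -/
def IsQuasiFSplitOfHeight (h : ℕ) : Prop :=
  IsLeast {n : ℕ | 1 ≤ n ∧ IsNQuasiFSplit p S n} h

end QuasiFSplit

/-! ### The modules `Q_f(l_0, …, l_n)` and the splitting-order sequence -/

section SplittingOrder

variable (p : ℕ) [hp : Fact p.Prime] (A : Type u) [CommRing A]

/-- The absolute Frobenius `x ↦ x ^ p` of `A / p`. -/
def frob : ModP p A →+* ModP p A where
  toFun x := x ^ p
  map_one' := one_pow p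
  map_mul' x y := mul_pow x y p
  map_zero' := zero_pow hp.out.ne_zero
  map_add' x y := by
    obtain ⟨r, hr⟩ := exists_add_pow_prime_eq hp.out x y
    rw [hr, natCast_modP]
    ring

/-- `F^e_* M` for an `A / p`-module `M`: the same additive group, on which `a` acts as
`a ^ (p ^ e)`. -/
def FPush (_p : ℕ) (_A : Type u) (_e : ℕ) (M : Type u) : Type u := M

instance (e : ℕ) (M : Type u) [h : AddCommGroup M] : AddCommGroup (FPush p A e M) := h

instance (e : ℕ) (M : Type u) [AddCommGroup M] [h : Module (ModP p A) M] :
    Module (ModP p A) (FPush p A e M) :=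
  letI : Module (ModP p A) M := h
  Module.compHom M (frob p A ^ e)

theorem frob_pow_apply (e : ℕ) (a : ModP p A) : (frob p A ^ e) a = a ^ p ^ e := by
  induction e with
  | zero => simp
  | succ e ih =>
    rw [pow_succ', RingHom.mul_def, RingHom.comp_apply, ih]
    change (a ^ p ^ e) ^ p = _
    rw [← pow_mul, ← pow_succ]

/-- An element of `M`, viewed in `F^e_* M`. -/
def FPush.of (e : ℕ) (M : Type u) [AddCommGroup M] : M →+ FPush p A e M := AddMonoidHom.id M

theorem FPush.smul_of (e : ℕ) (M : Type u) [AddCommGroup M] [Module (ModP p A) M]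
    (a : ModP p A) (x : M) : a • FPush.of p A e M x = FPush.of p A e M (a ^ p ^ e • x) := by
  rw [← frob_pow_apply]
  rfl

variable {A}

/-- `⨁_{i = 0}^{n} F^i_* (A / (p, f ^ p))`. -/
abbrev QAmbient (f : ModP p A) (n : ℕ) : Type u :=
  (i : Fin (n + 1)) → FPush p A i (ModP p A ⧸ Ideal.span {f ^ p})

/-- The `i`-th coordinate of the relation attached to `a_0, a_1, …`:
`a_0 f^{l_0}` for `i = 0`, and `- a_{i-1}^p d^{l_{i-1}} + a_i f^{l_i}` for `i > 0`. -/
def relCoord (f d : ModP p A) (l : ℕ → ℕ) (a : ℕ → ModP p A) : ℕ → ModP p A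
  | 0 => a 0 * f ^ l 0
  | i + 1 => -(a i ^ p * d ^ l i) + a (i + 1) * f ^ l (i + 1)

/-- The submodule of relations
`(a_0 f^{l_0}, -a_0^p d^{l_0} + a_1 f^{l_1}, …, -a_{n-1}^p d^{l_{n-1}} + a_n f^{l_n})`. -/
def relSubmodule (f d : ModP p A) (l : ℕ → ℕ) (n : ℕ) :
    Submodule (ModP p A) (QAmbient p f n) where
  carrier := {x | ∃ a : ℕ → ModP p A, ∀ i : Fin (n + 1),
    x i = FPush.of p A i _ (Ideal.Quotient.mk (Ideal.span {f ^ p}) (relCoord p f d l a i))}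
  zero_mem' := by
    refine ⟨fun _ => 0, fun i => ?_⟩
    have h : relCoord p f d l (fun _ => 0) i = 0 := by
      rcases (i : ℕ) with _ | j <;> simp [relCoord, hp.out.ne_zero]
    rw [h, map_zero, map_zero]
    rfl
  add_mem' := by
    rintro x y ⟨a, ha⟩ ⟨b, hb⟩
    refine ⟨fun i => a i + b i, fun i => ?_⟩
    have h : relCoord p f d l (fun i => a i + b i) i =
        relCoord p f d l a i + relCoord p f d l b i := by
      rcases (i : ℕ) with _ | j
      · simp only [relCoord]
        ring
      · have := (frob p A).map_add (a j) (b j)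
        change (a j + b j) ^ p = a j ^ p + b j ^ p at this
        simp only [relCoord, this]
        ring
    rw [h, map_add, map_add, ← ha, ← hb]
    rfl
  smul_mem' := by
    rintro c x ⟨a, ha⟩
    refine ⟨fun i => c ^ p ^ i * a i, fun i => ?_⟩
    have h : relCoord p f d l (fun i => c ^ p ^ i * a i) i =
        c ^ p ^ (i : ℕ) * relCoord p f d l a i := by
      rcases (i : ℕ) with _ | j
      · simp only [relCoord]
        ring
      · simp only [relCoord, mul_pow, ← pow_mul, ← pow_succ]
        ring
    rw [h, Pi.smul_apply, ha, FPush.smul_of]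
    rfl

/-- `Q_f(l_0, …, l_n)`, where `f` and `d = Δ(f)` are taken modulo `p`. -/
abbrev Q (f d : ModP p A) (l : ℕ → ℕ) (n : ℕ) : Type u :=
  QAmbient p f n ⧸ relSubmodule p f d l n

/-- The `A / p`-linear map `A / p → Q_f(l_0, …, l_n)`, `a ↦ (a, 0, …, 0)`. -/
def QPhiAux (f d : ModP p A) (l : ℕ → ℕ) (n : ℕ) : ModP p A →ₗ[ModP p A] Q p f d l n where
  toFun a := (relSubmodule p f d l n).mkQ
    (Pi.single 0 (FPush.of p A ((0 : Fin (n + 1)) : ℕ) _ (Ideal.Quotient.mk _ a)))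
  map_add' a b := by
    rw [map_add, map_add, Pi.single_add, map_add]
  map_smul' c a := by
    rw [RingHom.id_apply, ← map_smul, ← Pi.single_smul, FPush.smul_of]
    simp only [Fin.val_zero, pow_zero, pow_one]
    rfl

theorem QPhiAux_eq_zero (f d : ModP p A) (l : ℕ → ℕ) (n : ℕ) :
    QPhiAux p f d l n (f ^ (l 0 + 1)) = 0 := by
  refine (Submodule.Quotient.mk_eq_zero _).2 ⟨fun i => if i = 0 then f else 0, fun i => ?_⟩
  have hz : (Ideal.Quotient.mk (Ideal.span {f ^ p}) (f ^ p)) = 0 :=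
    Ideal.Quotient.eq_zero_iff_mem.2 (Ideal.mem_span_singleton_self _)
  refine Fin.cases ?_ (fun j => ?_) i
  · refine (Pi.single_eq_same _ _).trans ?_
    simp only [Fin.val_zero, relCoord, if_true]
    rw [pow_succ']
  · rw [Pi.single_eq_of_ne (Fin.succ_ne_zero j)]
    have h : Ideal.Quotient.mk (Ideal.span {f ^ p})
        (relCoord p f d l (fun i => if i = 0 then f else 0) (j.succ : Fin (n + 1))) = 0 := by
      rw [Fin.val_succ]
      simp only [relCoord, Nat.succ_ne_zero, if_false, zero_mul, add_zero]
      by_cases hj : (j : ℕ) = 0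
      · simp only [hj, if_true, map_neg, map_mul, hz, zero_mul, neg_zero]
      · simp only [hj, if_false, zero_pow hp.out.ne_zero, zero_mul, neg_zero, map_zero]
    rw [h, map_zero]

/-- The `A / p`-linear map `Φ_f(l_0, …, l_n) : A / (p, f^{l_0 + 1}) → Q_f(l_0, …, l_n)`,
`a ↦ (a, 0, …, 0)`. -/
def QPhi (f d : ModP p A) (l : ℕ → ℕ) (n : ℕ) :
    (ModP p A ⧸ Ideal.span {f ^ (l 0 + 1)}) →ₗ[ModP p A] Q p f d l n :=
  Submodule.liftQ (Ideal.span {f ^ (l 0 + 1)}) (QPhiAux p f d l n) (by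
    refine (Submodule.span_singleton_le_iff_mem _ _).2 ?_
    exact LinearMap.mem_ker.2 (QPhiAux_eq_zero p f d l n))

variable {p}

/-- The splitting-order sequence `s_0, s_1, …` of `f`: `s_0 = 0`; if some earlier term is `p` then
`s_n = p`; otherwise `s_n` is the largest `0 ≤ t ≤ p` such that `Φ_f(s_0, …, s_{n-1}, t)` is not
pure. (The set of these `t` always contains `0`, unless `f` is a unit modulo `p`; for such `f` it is
empty and the supremum is `0`.) -/
def splittingOrder {φ : A →+* A} (hφ : IsFrobeniusLift p φ) (f : A) (n : ℕ) : ℕ :=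
  open Classical in
  if n = 0 then 0
  else if ∃ i : Fin n, splittingOrder hφ f i = p then p
  else sSup {t : ℕ | t ≤ p ∧ ¬ IsPure (QPhi p (toModP p f) (toModP p (Delta hφ f))
    (fun i => if _h : i < n then splittingOrder hφ f i else t) n)}
termination_by n

end SplittingOrder

end QFSplit

end

/-!
The proof compares quasi-`F`-splitting of `A / f` with purity of `Φ_f(0, 1, …, 1)` and then reads
off the splitting-order sequence.

*Witt vectors of `A / f`.* As `A` is `p`-torsion free and carries a Frobenius lift `φ`, a Witt
vector `w` over `A` has additive coordinates `x_n`, determined by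
`p ^ n x_n = gh_n(w) - φ(gh_{n-1}(w))` with `gh_n` the ghost components (`wittCoord`). Modulo `p`
they identify `W_n(A) / p` with the sum of the `F^i_* (A / p)`, and the Teichmüller element `[f a]`
has the coordinates `(f a, Δ(f a), …)`, where the entries after the second are, modulo
`f ^ 2`, zero for odd `p`, while for `p = 2` the third one is `Δ(f a) ^ 2`. A unitriangular change
of coordinates (`twistedCoord`) removes this extra entry and adjusts the sign. Since `Δ(f a)` is
`a ^ p Δ(f)` modulo `p` and `f ^ 2`, the Witt vectors with coefficients in `(f)` then satisfy the
relations of `Q_f(0, 1, …, 1)` modulo `f ^ 2` (`exists_twistedCoord_succ_eq`). The errors in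
`(f ^ 2)` are harmless, because both the relation submodule and the image of `W((f))` contain all
sequences with terms in `(f ^ 2)` (`exists_dvd_coeff_twistedCoord_eq`). Hence `W_n(A / f) / p` is
`Q_f(0, 1, …, 1)` with `n` ones, compatibly with `Φ` (`wittToQ_eq_zero_iff`,
`isNQuasiFSplit_iff_exists_leftInverse`).

*Purity and splitting.* The module `Q_f(l_0, …, l_n)` is finite over the Noetherian ring `A / p`
because `φ` is finite, and a pure map from a cyclic module to a finite one over a Noetherian ring
splits (`IsPure.exists_leftInverse`). So `A / f` is `n`-quasi-`F`-split if and only if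
`Φ_f(0, 1, …, 1)` with `n` ones is pure (`isNQuasiFSplit_iff_isPure`).

*The sequence.* Extension by zero gives a map from `Q_f(0, 1, …, 1, t)`, with `n - 1` ones, to
`Q_f(0, 1, …, 1)`, with `h` ones, if `n = h` and `1 ≤ t`, or if `n < h` and `2 ≤ t`: in the second
case the parameter `a_n` becomes `a_n f ^ (t - 1)`, whose `p`-th power vanishes modulo `f ^ p`
(`IsPure.QPhi_of_le`). Therefore, when `A / f` is `h`-quasi-`F`-split, the map
`Φ_f(0, 1, …, 1, t)` can fail to be pure only for `t = 0` if `n = h`, and for `t ≤ 1` if `n < h`;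
the value `t = 1` decides whether `A / f` is `n`-quasi-`F`-split.
-/

noncomputable section

namespace QFSplit

universe u

/-! ### Pure maps and splittings -/

section Pure

open TensorProduct

variable {R : Type u} [CommRing R] {M N : Type u} [AddCommGroup M] [Module R M]
  [AddCommGroup N] [Module R N]

theorem IsPure.of_leftInverse {g : M →ₗ[R] N} {r : N →ₗ[R] M} (h : r ∘ₗ g = LinearMap.id) :
    IsPure g := by
  intro P _ _
  refine Function.LeftInverse.injective (g := r.lTensor P) fun x => ?_
  rw [← LinearMap.comp_apply, ← LinearMap.lTensor_comp, h, LinearMap.lTensor_id,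
    LinearMap.id_apply]

theorem IsPure.of_comp {N' : Type u} [AddCommGroup N'] [Module R N'] {g : M →ₗ[R] N}
    {k : N →ₗ[R] N'} (h : IsPure (k ∘ₗ g)) : IsPure g := by
  intro P _ _
  have := h P
  rw [LinearMap.lTensor_comp, LinearMap.coe_comp] at this
  exact this.of_comp

theorem IsPure.comp_equiv {M' : Type u} [AddCommGroup M'] [Module R M'] {g : M →ₗ[R] N}
    (h : IsPure g) (e : M' ≃ₗ[R] M) : IsPure (g ∘ₗ e.toLinearMap) := by
  intro P _ _
  rw [LinearMap.lTensor_comp, LinearMap.coe_comp]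
  exact (h P).comp (LinearEquiv.lTensor P e).injective

/-- A finite system of linear equations with constants in `M` that is solvable in `N` is solvable
in `M`, for a pure `g : M → N`: test purity on the cokernel of the coefficient matrix. -/
theorem IsPure.exists_sum_smul_eq {g : M →ₗ[R] N} (hg : IsPure g) {m k : ℕ}
    (T : Matrix (Fin m) (Fin k) R) (c : Fin m → M) (x : Fin k → N)
    (hx : ∀ i, ∑ j, T i j • x j = g (c i)) :
    ∃ y : Fin k → M, ∀ i, ∑ j, T i j • y j = c i := by
  let L : (Fin k → R) →ₗ[R] (Fin m → R) := T.mulVecLin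
  let π := (LinearMap.range L).mkQ
  have hπ : ∀ j, ∑ i, T i j • π (Pi.single i 1) = 0 := by
    intro j
    have : ∑ i, T i j • (Pi.single i 1 : Fin m → R) = L (Pi.single j 1) := by
      ext i
      simp [L, Finset.sum_apply, Pi.single_apply]
    simp only [← map_smul, ← map_sum]
    rw [this]
    exact (Submodule.Quotient.mk_eq_zero _).2 ⟨_, rfl⟩
  have h0 : ∑ i, π (Pi.single i 1) ⊗ₜ[R] c i = 0 := by
    apply hg
    rw [map_sum, map_zero]
    simp only [LinearMap.lTensor_tmul, ← hx, tmul_sum, ← smul_tmul]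
    rw [Finset.sum_comm]
    refine Finset.sum_eq_zero fun j _ => ?_
    rw [← sum_tmul, hπ, zero_tmul]
  have hex : Function.Exact (L.rTensor M) (π.rTensor M) :=
    rTensor_exact M (LinearMap.exact_map_mkQ_range L) (Submodule.mkQ_surjective _)
  obtain ⟨y, hy⟩ := (hex (∑ i, (Pi.single i 1 : Fin m → R) ⊗ₜ[R] c i)).1 (by
    rw [map_sum]
    simpa only [LinearMap.rTensor_tmul] using h0)
  let ev (q : ℕ) (j : Fin q) : (Fin q → R) ⊗[R] M →ₗ[R] M :=
    TensorProduct.lift ((LinearMap.lsmul R M) ∘ₗ LinearMap.proj j)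
  refine ⟨fun j => ev k j y, fun i => ?_⟩
  have h1 : ev m i (L.rTensor M y) = ∑ j, T i j • ev k j y := by
    clear hy
    induction y with
    | zero => simp
    | add y₁ y₂ h₁ h₂ => simp only [map_add, h₁, h₂, smul_add, Finset.sum_add_distrib]
    | tmul a b =>
      simp [ev, L, Matrix.mulVec, dotProduct, mul_smul]
  rw [← h1, hy, map_sum]
  simp [ev, Pi.single_apply, ite_smul]

/-- A pure map from a cyclic module to a finitely presented one splits. -/
theorem IsPure.exists_leftInverse [IsNoetherianRing R] [Module.Finite R N] {g : M →ₗ[R] N}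
    (hg : IsPure g) {e : M} (he : ∀ z : M, ∃ r : R, r • e = z) :
    ∃ r : N →ₗ[R] M, r ∘ₗ g = LinearMap.id := by
  obtain ⟨k, π, hπ⟩ := Module.Finite.exists_fin' R N
  obtain ⟨m, t, ht⟩ := Submodule.fg_iff_exists_fin_generating_family.1
    (IsNoetherian.noetherian (LinearMap.ker π))
  obtain ⟨b, hb⟩ := hπ (g e)
  have hsum : ∀ v : Fin k → R, ∑ j, v j • π (Pi.single j 1) = π v := by
    intro v
    conv_rhs => rw [pi_eq_sum_univ' v, map_sum]
    simp only [map_smul]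
  obtain ⟨y, hy⟩ := hg.exists_sum_smul_eq (m := m + 1) (Fin.cons b t)
    (Fin.cons e fun _ => 0) (fun j => π (Pi.single j 1)) (by
      refine Fin.cases ?_ fun i => ?_
      · rw [Fin.cons_zero, Fin.cons_zero, hsum, hb]
      · rw [Fin.cons_succ, Fin.cons_succ, hsum, map_zero]
        exact LinearMap.mem_ker.1 (ht ▸ Submodule.subset_span ⟨i, rfl⟩))
  let σ : (Fin k → R) →ₗ[R] M := Fintype.linearCombination R y
  have hσ : LinearMap.ker π ≤ LinearMap.ker σ := by
    rw [← ht, Submodule.span_le]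
    rintro _ ⟨i, rfl⟩
    have := hy i.succ
    rw [Fin.cons_succ, Fin.cons_succ] at this
    exact LinearMap.mem_ker.2 this
  refine ⟨(LinearMap.ker π).liftQ σ hσ ∘ₗ
    (π.quotKerEquivOfSurjective hπ).symm.toLinearMap, ?_⟩
  have key : ∀ v, (LinearMap.ker π).liftQ σ hσ
      ((π.quotKerEquivOfSurjective hπ).symm (π v)) = σ v := by
    intro v
    have : (π.quotKerEquivOfSurjective hπ).symm (π v) = (LinearMap.ker π).mkQ v := by
      rw [LinearEquiv.symm_apply_eq]
      rfl
    rw [this]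
    exact Submodule.liftQ_apply _ _ _
  ext z
  obtain ⟨r, rfl⟩ := he z
  simp only [LinearMap.comp_apply, map_smul, LinearMap.id_apply, LinearEquiv.coe_coe]
  rw [← hb, key]
  congr 1
  exact hy 0

end Pure

/-! ### Coordinates on Witt vectors attached to a Frobenius lift -/

section WittCoordinates

open WittVector

variable {p : ℕ} {A : Type u} [CommRing A] {φ : A →+* A}

theorem IsPTorsionFree.pow_cancel (hpt : IsPTorsionFree p A) (n : ℕ) {a b : A}
    (h : (p : A) ^ n * a = (p : A) ^ n * b) : a = b := by
  induction n with
  | zero => simpa using h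
  | succ n ih =>
    refine ih (sub_eq_zero.1 (hpt _ ?_))
    rw [pow_succ'] at h
    linear_combination h

theorem toModP_natCast_mul (a : A) : toModP p ((p : A) * a) = 0 := by
  rw [map_mul, map_natCast, natCast_modP, zero_mul]

theorem exists_higherDelta (hφ : IsFrobeniusLift p φ) (j : ℕ) (g : A) :
    ∃ c : A, (p : A) ^ (j + 1) * c = g ^ p ^ (j + 1) - φ g ^ p ^ j := by
  obtain ⟨c, hc⟩ := dvd_sub_pow_of_dvd_sub (hφ.dvd g) j
  exact ⟨c, by rw [← hc, ← pow_mul, ← pow_succ']⟩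

/-- The element `(g ^ (p ^ (j + 1)) - φ(g) ^ (p ^ j)) / p ^ (j + 1)`; for `j = 0` it is `Δ(g)`. -/
def higherDelta (hφ : IsFrobeniusLift p φ) (j : ℕ) (g : A) : A :=
  (exists_higherDelta hφ j g).choose

theorem pow_mul_higherDelta (hφ : IsFrobeniusLift p φ) (j : ℕ) (g : A) :
    (p : A) ^ (j + 1) * higherDelta hφ j g = g ^ p ^ (j + 1) - φ g ^ p ^ j :=
  (exists_higherDelta hφ j g).choose_spec

theorem higherDelta_zero_left (hpt : IsPTorsionFree p A) (hφ : IsFrobeniusLift p φ) (g : A) :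
    higherDelta hφ 0 g = Delta hφ g := by
  refine hpt.pow_cancel 1 ?_
  have h := pow_mul_higherDelta hφ 0 g
  simp only [zero_add, pow_zero, pow_one] at h ⊢
  rw [h, p_mul_Delta]

/-- The Witt vector with the single coefficient `c` in degree `n`, that is, `V^n [c]`. -/
def wittSingle (p : ℕ) (n : ℕ) (c : A) : WittVector p A :=
  WittVector.mk p fun i => if i = n then c else 0

theorem coeff_wittSingle (n i : ℕ) (c : A) :
    (wittSingle p n c).coeff i = if i = n then c else 0 := rfl

theorem coeff_wittSingle_of_lt {n i : ℕ} (h : i < n) (c : A) : (wittSingle p n c).coeff i = 0 := by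
  rw [coeff_wittSingle, if_neg h.ne]

theorem neg_one_pow_mul_self_mul (n : ℕ) (x : A) : (-1) ^ n * ((-1) ^ n * x) = x := by
  rw [← mul_assoc, ← mul_pow, neg_one_mul, neg_neg, one_pow, one_mul]

variable [hp : Fact p.Prime]

theorem higherDelta_apply_zero (hpt : IsPTorsionFree p A) (hφ : IsFrobeniusLift p φ) (j : ℕ) :
    higherDelta hφ j (0 : A) = 0 := by
  refine hpt.pow_cancel (j + 1) ?_
  rw [pow_mul_higherDelta, map_zero, zero_pow (pow_ne_zero _ hp.out.ne_zero),
    zero_pow (pow_ne_zero _ hp.out.ne_zero), sub_zero, mul_zero]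

/-- `Δ(f a) ≡ a ^ p Δ(f)` modulo `p` and `f ^ 2`. -/
theorem toModP_Delta_mul (hpt : IsPTorsionFree p A) (hφ : IsFrobeniusLift p φ) (f a : A) :
    ∃ c, toModP p (Delta hφ (f * a)) =
      toModP p a ^ p * toModP p (Delta hφ f) + toModP p f ^ 2 * c := by
  obtain ⟨q, hq⟩ := Nat.exists_eq_add_of_le hp.out.two_le
  have h : Delta hφ (f * a) = f ^ p * Delta hφ a + a ^ p * Delta hφ f
      - p * (Delta hφ a * Delta hφ f) := by
    refine hpt.pow_cancel 1 ?_
    have h1 := p_mul_Delta hφ f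
    have h2 := p_mul_Delta hφ a
    rw [pow_one, p_mul_Delta, map_mul, mul_pow]
    have h3 : φ f = f ^ p - p * Delta hφ f := by rw [h1]; ring
    have h4 : φ a = a ^ p - p * Delta hφ a := by rw [h2]; ring
    rw [h3, h4]
    ring
  refine ⟨toModP p f ^ q * toModP p (Delta hφ a), ?_⟩
  rw [h, map_sub, toModP_natCast_mul, sub_zero, ← mul_assoc, ← pow_add, ← hq]
  simp only [map_add, map_mul, map_pow]
  ring

/-- The constant `ε` of `A / p`: it is `1` if `p = 2` and `0` otherwise. -/
def twoIndicator (p : ℕ) (A : Type u) [CommRing A] : ModP p A := 0 ^ (p - 2)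

theorem twoIndicator_mul_neg_one_pow (m : ℕ) :
    twoIndicator p A * (-1) ^ m = twoIndicator p A := by
  rcases hp.out.eq_two_or_odd' with h | h
  · subst h
    have h2 : (2 : ModP 2 A) = 0 := by exact_mod_cast natCast_modP 2 A
    have : (-1 : ModP 2 A) = 1 := by linear_combination -h2
    rw [this, one_pow, mul_one]
  · have : p ≠ 2 := by rintro rfl; exact absurd h (by decide)
    have := hp.out.two_le
    rw [twoIndicator, zero_pow (by omega), zero_mul]

theorem twoIndicator_add_self : twoIndicator p A + twoIndicator p A = 0 := by
  have := twoIndicator_mul_neg_one_pow (p := p) (A := A) 1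
  rw [pow_one] at this
  linear_combination -this

theorem neg_one_pow_modP : (-1 : ModP p A) ^ p = -1 := by
  have h := (frob p A).map_neg 1
  rw [map_one] at h
  exact h

/-- Modulo `p` and `g ^ 2`, the element `higherDelta 1 g` vanishes for odd `p`, and is `Δ(g) ^ 2`
for `p = 2`. -/
theorem toModP_higherDelta_one (hpt : IsPTorsionFree p A) (hφ : IsFrobeniusLift p φ) (g : A) :
    ∃ c, toModP p (higherDelta hφ 1 g) =
      toModP p g ^ 2 * c + twoIndicator p A * toModP p (Delta hφ g) ^ p := by
  obtain ⟨q, hq⟩ := Nat.exists_eq_add_of_le hp.out.two_le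
  obtain ⟨r, hr⟩ := exists_add_pow_prime_eq hp.out (g ^ p) (-(p * Delta hφ g))
  have h : higherDelta hφ 1 g =
      g ^ p * Delta hφ g * r - (-1) ^ p * (p : A) ^ q * Delta hφ g ^ p := by
    refine hpt.pow_cancel 2 ?_
    have h1 := pow_mul_higherDelta hφ 1 g
    have h2 : φ g = g ^ p + -(p * Delta hφ g) := by rw [p_mul_Delta]; ring
    have h3 : (-(p * Delta hφ g)) ^ p =
        (p : A) ^ 2 * ((-1) ^ p * (p : A) ^ q * Delta hφ g ^ p) := by
      rw [neg_pow, mul_pow]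
      have : (p : A) ^ p = (p : A) ^ 2 * (p : A) ^ q := by rw [← pow_add, ← hq]
      rw [this]
      ring
    rw [pow_one, h2, hr, h3, one_add_one_eq_two] at h1
    rw [h1]
    have : (g ^ p) ^ p = g ^ p ^ 2 := by rw [← pow_mul, sq]
    rw [this]
    ring
  refine ⟨toModP p g ^ q * toModP p (Delta hφ g) * toModP p r, ?_⟩
  have he : toModP p ((-1) ^ p * (p : A) ^ q) = -twoIndicator p A := by
    rw [map_mul, map_pow, map_pow, map_neg, map_one, map_natCast, natCast_modP, neg_one_pow_modP,
      twoIndicator, hq, Nat.add_sub_cancel_left, neg_one_mul]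
  rw [h, map_sub, map_mul _ _ (Delta hφ g ^ p), he]
  have : toModP p (g ^ p) = toModP p g ^ 2 * toModP p g ^ q := by
    rw [map_pow, ← pow_add, ← hq]
  rw [map_mul, map_mul, this, map_pow]
  ring

/-- Modulo `p`, the elements `higherDelta j g` with `2 ≤ j` are divisible by `g ^ 2`. -/
theorem toModP_higherDelta_add_two (hpt : IsPTorsionFree p A) (hφ : IsFrobeniusLift p φ) (j : ℕ)
    (g : A) : ∃ c, toModP p (higherDelta hφ (j + 2) g) = toModP p g ^ 2 * c := by
  obtain ⟨r, hr⟩ := exists_add_pow_prime_eq hp.out (g ^ p ^ (j + 2))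
    (-(p ^ (j + 2) * higherDelta hφ (j + 1) g))
  obtain ⟨q, hq⟩ : ∃ q, (j + 2) * p = (j + 3) + 1 + q := by
    refine Nat.exists_eq_add_of_le ?_
    have := hp.out.two_le
    nlinarith
  obtain ⟨s, hs⟩ : ∃ s, p ^ (j + 2) = 2 + s := by
    refine Nat.exists_eq_add_of_le (hp.out.two_le.trans ?_)
    exact Nat.le_self_pow (by omega) p
  have h : higherDelta hφ (j + 2) g = g ^ p ^ (j + 2) * higherDelta hφ (j + 1) g * r
      - p * ((-1) ^ p * (p : A) ^ q * higherDelta hφ (j + 1) g ^ p) := by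
    refine hpt.pow_cancel (j + 3) ?_
    have h1 := pow_mul_higherDelta hφ (j + 2) g
    have h2 : φ g ^ p ^ (j + 1) = g ^ p ^ (j + 2) + -(p ^ (j + 2) * higherDelta hφ (j + 1) g) := by
      rw [pow_mul_higherDelta hφ (j + 1) g]
      ring
    have h3 : (-((p : A) ^ (j + 2) * higherDelta hφ (j + 1) g)) ^ p =
        (p : A) ^ (j + 3) * (p * ((-1) ^ p * (p : A) ^ q * higherDelta hφ (j + 1) g ^ p)) := by
      rw [neg_pow, mul_pow, ← pow_mul, hq]
      ring
    have h4 : φ g ^ p ^ (j + 2) = (φ g ^ p ^ (j + 1)) ^ p := by rw [← pow_mul, ← pow_succ]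
    have h5 : (g ^ p ^ (j + 2)) ^ p = g ^ p ^ (j + 2 + 1) := by rw [← pow_mul, ← pow_succ]
    rw [h1, h4, h2, hr, h3, h5]
    ring
  refine ⟨toModP p g ^ s * toModP p (higherDelta hφ (j + 1) g) * toModP p r, ?_⟩
  rw [h, map_sub, toModP_natCast_mul, hs, pow_add]
  simp only [map_mul, map_pow]
  ring

/-- The coordinates of a Witt vector `w` with respect to the Frobenius lift: if `s : A → W(A)` is
the section attached to `φ`, then `w = ∑ V^n s(x_n)` with `x_n = wittCoord w n`. The section is not
needed: `p ^ n x_n` is the difference of the `n`-th ghost component of `w` and the image under `φ`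
of the preceding one. -/
def wittCoord (hφ : IsFrobeniusLift p φ) (n : ℕ) (w : WittVector p A) : A :=
  w.coeff n + ∑ i ∈ Finset.range n, higherDelta hφ (n - 1 - i) (w.coeff i)

theorem pow_succ_mul_wittCoord (hφ : IsFrobeniusLift p φ) (n : ℕ) (w : WittVector p A) :
    (p : A) ^ (n + 1) * wittCoord hφ (n + 1) w =
      ghostComponent (n + 1) w - φ (ghostComponent n w) := by
  rw [ghostComponent_apply, ghostComponent_apply, aeval_wittPolynomial, aeval_wittPolynomial,
    Finset.sum_range_succ, Nat.sub_self, pow_zero, pow_one, add_sub_right_comm, map_sum,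
    ← Finset.sum_sub_distrib, wittCoord, mul_add, Finset.mul_sum, add_comm]
  congr 1
  refine Finset.sum_congr rfl fun i hi => ?_
  have hi' : i ≤ n := by simpa [Nat.lt_succ_iff] using hi
  obtain ⟨k, rfl⟩ := Nat.exists_eq_add_of_le hi'
  have h1 : i + k + 1 - 1 - i = k := by omega
  have h2 : i + k + 1 - i = k + 1 := by omega
  have h3 : i + k - i = k := by omega
  rw [h1, h2, h3, add_assoc, pow_add, mul_assoc, pow_mul_higherDelta, map_mul, map_pow, map_pow,
    map_natCast, mul_sub]

theorem wittCoord_zero_left (hφ : IsFrobeniusLift p φ) (w : WittVector p A) :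
    wittCoord hφ 0 w = ghostComponent 0 w := by
  rw [ghostComponent_apply, aeval_wittPolynomial, wittCoord]
  simp

theorem wittCoord_add (hpt : IsPTorsionFree p A) (hφ : IsFrobeniusLift p φ) (n : ℕ)
    (v w : WittVector p A) : wittCoord hφ n (v + w) = wittCoord hφ n v + wittCoord hφ n w := by
  cases n with
  | zero => simp only [wittCoord_zero_left, map_add]
  | succ n =>
    refine hpt.pow_cancel (n + 1) ?_
    rw [mul_add]
    simp only [pow_succ_mul_wittCoord, map_add]
    ring

theorem wittCoord_one (hpt : IsPTorsionFree p A) (hφ : IsFrobeniusLift p φ) (n : ℕ) :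
    wittCoord hφ (n + 1) (1 : WittVector p A) = 0 := by
  refine hpt.pow_cancel (n + 1) ?_
  rw [pow_succ_mul_wittCoord, map_one, map_one, map_one, sub_self, mul_zero]

theorem wittCoord_frobenius_teichmuller_mul (hpt : IsPTorsionFree p A) (hφ : IsFrobeniusLift p φ)
    (n : ℕ) (a : A) (w : WittVector p A) :
    toModP p (wittCoord hφ n (frobenius (teichmuller p a) * w)) =
      toModP p a ^ p ^ (n + 1) * toModP p (wittCoord hφ n w) := by
  have hg : ∀ k, ghostComponent k (frobenius (teichmuller p a) * w) =
      a ^ p ^ (k + 1) * ghostComponent k w := fun k => by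
    rw [map_mul, ghostComponent_frobenius, ghostComponent_teichmuller]
  cases n with
  | zero => rw [wittCoord_zero_left, wittCoord_zero_left, hg, map_mul, map_pow]
  | succ n =>
    have h : wittCoord hφ (n + 1) (frobenius (teichmuller p a) * w) =
        a ^ p ^ (n + 2) * wittCoord hφ (n + 1) w
          + p * (higherDelta hφ (n + 1) a * φ (ghostComponent n w)) := by
      refine hpt.pow_cancel (n + 1) ?_
      have h1 := pow_succ_mul_wittCoord hφ n w
      have h2 := pow_mul_higherDelta hφ (n + 1) a
      rw [pow_succ_mul_wittCoord, hg, hg, map_mul, map_pow]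
      linear_combination (-a ^ p ^ (n + 2)) * h1 - (φ (ghostComponent n w)) * h2
    rw [h, map_add, toModP_natCast_mul, add_zero, map_mul, map_pow]

theorem wittCoord_of_coeff_eq_zero (hpt : IsPTorsionFree p A) (hφ : IsFrobeniusLift p φ) {n : ℕ}
    {w : WittVector p A} (h : ∀ i < n, w.coeff i = 0) : wittCoord hφ n w = w.coeff n := by
  rw [wittCoord, Finset.sum_eq_zero, add_zero]
  intro i hi
  rw [h i (Finset.mem_range.1 hi), higherDelta_apply_zero hpt]

/-- The coordinate `wittCoord` as an additive map. -/
def wittCoordHom (hpt : IsPTorsionFree p A) (hφ : IsFrobeniusLift p φ) (n : ℕ) :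
    WittVector p A →+ A :=
  AddMonoidHom.mk' (wittCoord hφ n) (wittCoord_add hpt hφ n)

/-- The coordinates `wittCoord` modulo `p`, modified so that on Witt vectors with coefficients in
`(f)` they satisfy the relations that define `Q_f(0, 1, …, 1)`. The sign matters for odd `p` only;
the added `p`-th power of the preceding coordinate is present for `p = 2` only, where it cancels
the contribution of `higherDelta 1`. -/
def twistedCoord (hpt : IsPTorsionFree p A) (hφ : IsFrobeniusLift p φ) :
    ℕ → WittVector p A →+ ModP p A
  | 0 => (toModP p).toAddMonoidHom.comp (wittCoordHom hpt hφ 0)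
  | 1 => -(toModP p).toAddMonoidHom.comp (wittCoordHom hpt hφ 1)
  | n + 2 => (AddMonoidHom.mulLeft ((-1) ^ n)).comp
        ((toModP p).toAddMonoidHom.comp (wittCoordHom hpt hφ (n + 2))) +
      (AddMonoidHom.mulLeft (twoIndicator p A)).comp
        ((frob p A).toAddMonoidHom.comp (twistedCoord hpt hφ (n + 1)))

variable (hpt : IsPTorsionFree p A) (hφ : IsFrobeniusLift p φ)

theorem twistedCoord_zero_left (w : WittVector p A) :
    twistedCoord hpt hφ 0 w = toModP p (wittCoord hφ 0 w) := by
  rw [twistedCoord]; rfl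

theorem twistedCoord_one_left (w : WittVector p A) :
    twistedCoord hpt hφ 1 w = -toModP p (wittCoord hφ 1 w) := by
  rw [twistedCoord]; rfl

theorem twistedCoord_add_two (n : ℕ) (w : WittVector p A) :
    twistedCoord hpt hφ (n + 2) w = (-1) ^ n * toModP p (wittCoord hφ (n + 2) w) +
      twoIndicator p A * twistedCoord hpt hφ (n + 1) w ^ p := by
  rw [twistedCoord]; rfl

theorem twistedCoord_frobenius_teichmuller_mul (n : ℕ) (a : A) (w : WittVector p A) :
    twistedCoord hpt hφ n (frobenius (teichmuller p a) * w) =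
      toModP p a ^ p ^ (n + 1) * twistedCoord hpt hφ n w := by
  induction n using twistedCoord.induct with
  | case1 =>
    rw [twistedCoord_zero_left, twistedCoord_zero_left, wittCoord_frobenius_teichmuller_mul hpt]
  | case2 =>
    rw [twistedCoord_one_left, twistedCoord_one_left, wittCoord_frobenius_teichmuller_mul hpt,
      mul_neg]
  | case3 n ih =>
    simp only [Nat.succ_eq_add_one, add_assoc, one_add_one_eq_two] at ih ⊢
    rw [twistedCoord_add_two, twistedCoord_add_two, wittCoord_frobenius_teichmuller_mul hpt, ih,
      mul_pow, ← pow_mul, ← pow_succ]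
    ring

theorem twistedCoord_zero_apply_one : twistedCoord hpt hφ 0 (1 : WittVector p A) = 1 := by
  rw [twistedCoord_zero_left, wittCoord_zero_left, map_one, map_one]

theorem twistedCoord_succ_apply_one (n : ℕ) :
    twistedCoord hpt hφ (n + 1) (1 : WittVector p A) = 0 := by
  induction n with
  | zero => rw [twistedCoord_one_left, wittCoord_one hpt, map_zero, neg_zero]
  | succ n ih =>
    rw [twistedCoord_add_two, wittCoord_one hpt, ih, map_zero, zero_pow hp.out.ne_zero]
    ring

theorem twistedCoord_of_coeff_eq_zero {n : ℕ} {w : WittVector p A} (h : ∀ i < n, w.coeff i = 0) :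
    twistedCoord hpt hφ n w = (-1) ^ n * toModP p (w.coeff n) := by
  induction n using twistedCoord.induct with
  | case1 =>
    rw [twistedCoord_zero_left, wittCoord_of_coeff_eq_zero hpt hφ h, pow_zero, one_mul]
  | case2 =>
    rw [twistedCoord_one_left, wittCoord_of_coeff_eq_zero hpt hφ h, pow_one, neg_one_mul]
  | case3 n ih =>
    simp only [Nat.succ_eq_add_one, add_assoc, one_add_one_eq_two] at h ⊢
    rw [twistedCoord_add_two, wittCoord_of_coeff_eq_zero hpt hφ h,
      ih fun i hi => h i (hi.trans (Nat.lt_succ_self _)), h _ (Nat.lt_succ_self _), map_zero,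
      mul_zero, zero_pow hp.out.ne_zero, mul_zero, add_zero, pow_add]
    ring

/-- On a Witt vector with coefficients `f a_0, f a_1, …`, the coordinates `wittCoord` modulo `p`
and `f ^ 2`. -/
theorem exists_wittCoord_eq (hpt : IsPTorsionFree p A) (hφ : IsFrobeniusLift p φ) {f : A}
    {a : ℕ → A} {w : WittVector p A}
    (hw : ∀ i, w.coeff i = f * a i) (n : ℕ) :
    ∃ c, toModP p (wittCoord hφ (n + 2) w) =
      toModP p f * toModP p (a (n + 2)) + toModP p (a (n + 1)) ^ p * toModP p (Delta hφ f)
      + twoIndicator p A * (toModP p (a n) ^ p * toModP p (Delta hφ f)) ^ p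
      + toModP p f ^ 2 * c := by
  obtain ⟨q, hq⟩ := Nat.exists_eq_add_of_le hp.out.two_le
  obtain ⟨c₀, h₀⟩ := toModP_Delta_mul hpt hφ f (a (n + 1))
  obtain ⟨c₁, h₁⟩ := toModP_higherDelta_one hpt hφ (f * a n)
  obtain ⟨c₂, h₂⟩ := toModP_Delta_mul hpt hφ f (a n)
  have h₃ : ∀ i ∈ Finset.range n,
      ∃ c, toModP p (higherDelta hφ (n + 1 - i) (f * a i)) = toModP p f ^ 2 * c := by
    intro i hi
    obtain ⟨j, hj⟩ : ∃ j, n + 1 - i = j + 2 :=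
      ⟨n - 1 - i, by have := Finset.mem_range.1 hi; omega⟩
    obtain ⟨c, hc⟩ := toModP_higherDelta_add_two hpt hφ j (f * a i)
    exact ⟨toModP p (a i) ^ 2 * c, by rw [hj, hc, map_mul]; ring⟩
  choose! c₃ h₃ using h₃
  have h₄ : toModP p (Delta hφ (f * a n)) ^ p =
      (toModP p (a n) ^ p * toModP p (Delta hφ f)) ^ p
        + toModP p f ^ 2 * (toModP p f ^ (2 * p - 2) * c₂ ^ p) := by
    have hpp : toModP p f ^ 2 * (toModP p f ^ (2 * p - 2) * c₂ ^ p) =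
        (toModP p f ^ 2 * c₂) ^ p := by
      rw [← mul_assoc, ← pow_add, mul_pow, ← pow_mul]
      congr 2
      omega
    rw [hpp, h₂]
    exact (frob p A).map_add _ _
  refine ⟨c₀ + toModP p (a n) ^ 2 * c₁ + twoIndicator p A * (toModP p f ^ (2 * p - 2) * c₂ ^ p)
    + ∑ i ∈ Finset.range n, c₃ i, ?_⟩
  rw [wittCoord, Finset.sum_range_succ, Finset.sum_range_succ]
  simp only [hw]
  have e1 : n + 2 - 1 - (n + 1) = 0 := by omega
  have e2 : n + 2 - 1 - n = 1 := by omega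
  have e3 : n + 2 - 1 = n + 1 := by omega
  rw [e1, e2, e3, map_add, map_add, map_add, map_sum, Finset.sum_congr rfl h₃,
    higherDelta_zero_left hpt, h₀, h₁, h₄, ← Finset.mul_sum, map_mul, map_mul]
  ring

/-- On Witt vectors with coefficients in `(f)`, the coordinates `twistedCoord` satisfy, modulo
`f ^ 2`, the relations that define `Q_f(0, 1, …, 1)`. -/
theorem exists_twistedCoord_succ_eq (hpt : IsPTorsionFree p A) (hφ : IsFrobeniusLift p φ) {f : A}
    {a : ℕ → A} {w : WittVector p A}
    (hw : ∀ i, w.coeff i = f * a i) (n : ℕ) :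
    ∃ c, twistedCoord hpt hφ (n + 1) w =
      -(((-1) ^ n * toModP p (a n)) ^ p * toModP p (Delta hφ f))
      + (-1) ^ (n + 1) * toModP p (a (n + 1)) * toModP p f + toModP p f ^ 2 * c := by
  induction n with
  | zero =>
    obtain ⟨c, hc⟩ := toModP_Delta_mul hpt hφ f (a 0)
    refine ⟨-c, ?_⟩
    rw [twistedCoord_one_left, wittCoord, Finset.sum_range_one, hw, hw, map_add,
      higherDelta_zero_left hpt, hc, map_mul]
    ring
  | succ n ih =>
    obtain ⟨c, hc⟩ := ih
    obtain ⟨e, he⟩ := exists_wittCoord_eq hpt hφ hw n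
    obtain ⟨q, hq⟩ := Nat.exists_eq_add_of_le hp.out.two_le
    have hp' : twistedCoord hpt hφ (n + 1) w ^ p =
        (-1) ^ (n * p * p + 1) * (toModP p (a n) ^ p * toModP p (Delta hφ f)) ^ p
        + toModP p f ^ 2 * (toModP p f ^ q *
          ((-1) ^ (n + 1) * toModP p (a (n + 1)) + toModP p f * c) ^ p) := by
      have h1 : twistedCoord hpt hφ (n + 1) w =
          -1 * ((-1) ^ (n * p) * (toModP p (a n) ^ p * toModP p (Delta hφ f))) +
          toModP p f * ((-1) ^ (n + 1) * toModP p (a (n + 1)) + toModP p f * c) := by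
        rw [hc]
        ring
      have h2 : ∀ x y : ModP p A, (x + y) ^ p = x ^ p + y ^ p := (frob p A).map_add
      rw [h1, h2, ← mul_assoc (toModP p f ^ 2), ← pow_add, ← hq, mul_pow (-1), neg_one_pow_modP,
        mul_pow ((-1) ^ (n * p)), ← pow_mul (-1), mul_pow (toModP p f)]
      ring
    refine ⟨(-1) ^ n * e + twoIndicator p A * (toModP p f ^ q *
          ((-1) ^ (n + 1) * toModP p (a (n + 1)) + toModP p f * c) ^ p), ?_⟩
    have hs : ((-1 : ModP p A) ^ (n + 1)) ^ p = (-1) ^ (n + 1) := by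
      rw [← pow_mul, mul_comm, pow_mul, neg_one_pow_modP]
    have t1 := twoIndicator_mul_neg_one_pow (p := p) (A := A) n
    have t2 := twoIndicator_mul_neg_one_pow (p := p) (A := A) (n * p * p + 1)
    have t3 := twoIndicator_add_self (p := p) (A := A)
    rw [twistedCoord_add_two, he, hp', mul_pow ((-1) ^ (n + 1)), hs]
    linear_combination (toModP p (a n) ^ p * toModP p (Delta hφ f)) ^ p * (t1 + t2 + t3)

theorem coeff_eq_zero_iff_truncate {n : ℕ} {w : WittVector p A} :
    (∀ i < n, w.coeff i = 0) ↔ truncate n w = 0 := by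
  rw [← RingHom.mem_ker, mem_ker_truncate]

theorem dvd_coeff_iff_map {g : A} {w : WittVector p A} :
    (∀ i, g ∣ w.coeff i) ↔ WittVector.map (Ideal.Quotient.mk (Ideal.span {g})) w = 0 := by
  rw [WittVector.ext_iff]
  refine forall_congr' fun i => ?_
  rw [map_coeff, zero_coeff, Ideal.Quotient.eq_zero_iff_mem, Ideal.mem_span_singleton]

theorem twistedCoord_wittSingle_of_lt {n i : ℕ} (h : i < n) (c : A) :
    twistedCoord hpt hφ i (wittSingle p n c) = 0 := by
  rw [twistedCoord_of_coeff_eq_zero hpt hφ fun j hj => coeff_wittSingle_of_lt (hj.trans h) c,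
    coeff_wittSingle_of_lt h, map_zero, mul_zero]

theorem twistedCoord_wittSingle_self (n : ℕ) (c : A) :
    twistedCoord hpt hφ n (wittSingle p n c) = (-1) ^ n * toModP p c := by
  rw [twistedCoord_of_coeff_eq_zero hpt hφ fun j hj => coeff_wittSingle_of_lt hj c,
    coeff_wittSingle, if_pos rfl]

theorem exists_twistedCoord_eq (x : ℕ → ModP p A) (n : ℕ) :
    ∃ w : WittVector p A, ∀ i < n, twistedCoord hpt hφ i w = x i := by
  induction n with
  | zero => exact ⟨0, by simp⟩
  | succ n ih =>
    obtain ⟨w, hw⟩ := ih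
    obtain ⟨c, hc⟩ : ∃ c, toModP p c = (-1) ^ n * (x n - twistedCoord hpt hφ n w) :=
      Ideal.Quotient.mk_surjective _
    refine ⟨w + wittSingle p n c, fun i hi => ?_⟩
    rcases (Nat.lt_succ_iff.1 hi).lt_or_eq with h | rfl
    · rw [map_add, hw i h, twistedCoord_wittSingle_of_lt hpt hφ h, add_zero]
    · rw [map_add, twistedCoord_wittSingle_self, hc, neg_one_pow_mul_self_mul]
      ring

/-- Every sequence with terms in `(f ^ 2)` is realised by the coordinates of a Witt vector with
coefficients in `(f ^ 2)`. -/
theorem exists_dvd_coeff_twistedCoord_eq (f : A) (x : ℕ → ModP p A) (n : ℕ) :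
    ∃ w : WittVector p A, (∀ i, f ^ 2 ∣ w.coeff i) ∧
      ∀ i < n, twistedCoord hpt hφ i w = toModP p f ^ 2 * x i := by
  induction n with
  | zero => exact ⟨0, by simp, by simp⟩
  | succ n ih =>
    obtain ⟨w, hw, hwx⟩ := ih
    obtain ⟨b, hb⟩ : ∃ b, twistedCoord hpt hφ n w = toModP p f ^ 2 * b := by
      choose a ha using hw
      cases n with
      | zero =>
        refine ⟨toModP p (a 0), ?_⟩
        rw [twistedCoord_of_coeff_eq_zero hpt hφ (by simp), ha, map_mul, map_pow]
        ring
      | succ n =>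
        obtain ⟨q, hq⟩ := Nat.exists_eq_add_of_le hp.out.two_le
        obtain ⟨c, hc⟩ := exists_twistedCoord_succ_eq hpt hφ (f := f) (a := fun i => f * a i)
          (w := w) (fun i => by rw [ha]; ring) n
        have h : (toModP p (f * a n)) ^ p =
            toModP p f ^ 2 * (toModP p f ^ q * toModP p (a n) ^ p) := by
          rw [map_mul, mul_pow, ← mul_assoc, ← pow_add, ← hq]
        rw [mul_pow, h, map_mul] at hc
        refine ⟨-(((-1) ^ n) ^ p * (toModP p f ^ q * toModP p (a n) ^ p) * toModP p (Delta hφ f))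
          + (-1) ^ (n + 1) * toModP p (a (n + 1)) + c, ?_⟩
        rw [hc]
        ring
    obtain ⟨c, hc⟩ : ∃ c, toModP p c = (-1) ^ n * (x n - b) := Ideal.Quotient.mk_surjective _
    refine ⟨w + wittSingle p n (f ^ 2 * c), ?_, fun i hi => ?_⟩
    · have h : ∀ i, f ^ 2 ∣ (wittSingle p n (f ^ 2 * c)).coeff i := by
        intro i
        rw [coeff_wittSingle]
        split_ifs
        exacts [dvd_mul_right _ _, dvd_zero _]
      rw [dvd_coeff_iff_map] at hw h ⊢
      rw [map_add, hw, h, add_zero]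
    · rcases (Nat.lt_succ_iff.1 hi).lt_or_eq with h | rfl
      · rw [map_add, hwx i h, twistedCoord_wittSingle_of_lt hpt hφ h, add_zero]
      · rw [map_add, twistedCoord_wittSingle_self, hb, map_mul, map_pow, hc,
          mul_left_comm, neg_one_pow_mul_self_mul]
        ring

/-- A Witt vector whose first `n` coordinates vanish modulo `p` is divisible by `p` in
`W_n(A)`. -/
theorem exists_truncate_eq_of_twistedCoord_eq_zero (n : ℕ) (w : WittVector p A)
    (h : ∀ i < n, twistedCoord hpt hφ i w = 0) :
    ∃ v : WittVector p A, truncate n (w - (p : WittVector p A) * v) = 0 := by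
  induction n with
  | zero => exact ⟨0, coeff_eq_zero_iff_truncate.1 fun i hi => absurd hi (Nat.not_lt_zero i)⟩
  | succ n ih =>
    obtain ⟨v, hv⟩ := ih fun i hi => h i (hi.trans (Nat.lt_succ_self _))
    have hp0 (y : WittVector p A) : twistedCoord hpt hφ n ((p : WittVector p A) * y) = 0 := by
      rw [← nsmul_eq_mul, map_nsmul, nsmul_eq_mul, natCast_modP, zero_mul]
    have h0 : toModP p ((w - (p : WittVector p A) * v).coeff n) = 0 := by
      have := twistedCoord_of_coeff_eq_zero hpt hφ (coeff_eq_zero_iff_truncate.2 hv)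
      rw [map_sub, hp0, h n (Nat.lt_succ_self _), sub_zero] at this
      rw [← neg_one_pow_mul_self_mul n (toModP p _), ← this, mul_zero]
    obtain ⟨c, hc⟩ := Ideal.mem_span_singleton.1 (Ideal.Quotient.eq_zero_iff_mem.1 h0)
    have hs : truncate n (wittSingle p n c) = 0 :=
      coeff_eq_zero_iff_truncate.1 fun i hi => coeff_wittSingle_of_lt hi c
    have hd : w - (p : WittVector p A) * (v + wittSingle p n c) =
        (w - p * v) - p * wittSingle p n c := by ring
    have hz : truncate n (w - (p : WittVector p A) * (v + wittSingle p n c)) = 0 := by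
      rw [hd, map_sub, hv, map_mul, hs, mul_zero, sub_zero]
    refine ⟨v + wittSingle p n c, coeff_eq_zero_iff_truncate.1 fun i hi => ?_⟩
    rcases (Nat.lt_succ_iff.1 hi).lt_or_eq with hi | rfl
    · exact coeff_eq_zero_iff_truncate.2 hz i hi
    -- the leading coefficient is the value of the additive map `wittCoord`
    · rw [← wittCoord_of_coeff_eq_zero hpt hφ (coeff_eq_zero_iff_truncate.2 hz), hd]
      change wittCoordHom hpt hφ i _ = 0
      rw [map_sub, ← nsmul_eq_mul p (wittSingle p i c), map_nsmul, nsmul_eq_mul]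
      change wittCoord hφ i _ - p * wittCoord hφ i _ = 0
      rw [wittCoord_of_coeff_eq_zero hpt hφ (coeff_eq_zero_iff_truncate.2 hv),
        wittCoord_of_coeff_eq_zero hpt hφ (coeff_eq_zero_iff_truncate.2 hs), hc, coeff_wittSingle,
        if_pos rfl, sub_self]

end WittCoordinates

/-! ### Comparison of the Witt vectors of `A / f` with `Q_f(0, 1, …, 1)` -/

section Comparison

open WittVector

variable {p : ℕ} [hp : Fact p.Prime] {A : Type u} [CommRing A] {φ : A →+* A}

theorem mk_mem_relSubmodule {f d : ModP p A} {l : ℕ → ℕ} {n : ℕ} (x : ℕ → ModP p A) :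
    (fun i : Fin (n + 1) => FPush.of p A i _ (Ideal.Quotient.mk (Ideal.span {f ^ p}) (x i))) ∈
      relSubmodule p f d l n ↔
    ∃ a : ℕ → ModP p A, ∀ i ≤ n, f ^ p ∣ x i - relCoord p f d l a i := by
  refine exists_congr fun a => ?_
  have key : ∀ i : ℕ, f ^ p ∣ x i - relCoord p f d l a i ↔
      Ideal.Quotient.mk (Ideal.span {f ^ p}) (x i) =
        Ideal.Quotient.mk (Ideal.span {f ^ p}) (relCoord p f d l a i) := fun i => by
    rw [Ideal.Quotient.mk_eq_mk_iff_sub_mem, Ideal.mem_span_singleton]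
  exact ⟨fun h i hi => (key i).2 (h ⟨i, Nat.lt_succ_of_le hi⟩),
    fun h i => (key i).1 (h i (Nat.le_of_lt_succ i.2))⟩

/-- The class in `Q_f(l_0, …, l_n)` of `(x_0, …, x_n)`, as an additive map. -/
def qMk (f d : ModP p A) (l : ℕ → ℕ) (n : ℕ) : (ℕ → ModP p A) →+ Q p f d l n where
  toFun x := (relSubmodule p f d l n).mkQ fun i : Fin (n + 1) =>
    FPush.of p A i _ (Ideal.Quotient.mk (Ideal.span {f ^ p}) (x i))
  map_zero' := by
    rw [← map_zero (relSubmodule p f d l n).mkQ]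
    rfl
  map_add' x y := by
    rw [← map_add]
    rfl

theorem qMk_eq_zero {f d : ModP p A} {l : ℕ → ℕ} {n : ℕ} {x : ℕ → ModP p A} :
    qMk f d l n x = 0 ↔
      ∃ a : ℕ → ModP p A, ∀ i ≤ n, f ^ p ∣ x i - relCoord p f d l a i :=
  (Submodule.Quotient.mk_eq_zero _).trans (mk_mem_relSubmodule x)

theorem qMk_surjective (f d : ModP p A) (l : ℕ → ℕ) (n : ℕ) :
    Function.Surjective (qMk f d l n) := by
  intro q
  obtain ⟨x, rfl⟩ := Submodule.mkQ_surjective _ q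
  have h : ∀ i : Fin (n + 1), ∃ y : ModP p A,
      FPush.of p A i _ (Ideal.Quotient.mk (Ideal.span {f ^ p}) y) = x i := fun i =>
    Ideal.Quotient.mk_surjective (I := Ideal.span {f ^ p}) (x i)
  choose y hy using h
  refine ⟨fun i => if hi : i < n + 1 then y ⟨i, hi⟩ else 0, ?_⟩
  change (relSubmodule p f d l n).mkQ _ = _
  congr 1
  funext i
  rw [← hy]
  simp only [i.2, dif_pos, Fin.eta]

theorem smul_qMk (f d : ModP p A) (l : ℕ → ℕ) (n : ℕ) (c : ModP p A) (x : ℕ → ModP p A) :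
    c • qMk f d l n x = qMk f d l n fun i => c ^ p ^ i * x i := by
  change c • (relSubmodule p f d l n).mkQ _ = _
  rw [← map_smul]
  change (relSubmodule p f d l n).mkQ _ = (relSubmodule p f d l n).mkQ _
  congr 1
  funext i
  exact FPush.smul_of p A i (ModP p A ⧸ Ideal.span {f ^ p}) c (Ideal.Quotient.mk _ (x i))

theorem QPhiAux_eq_qMk (f d : ModP p A) (l : ℕ → ℕ) (n : ℕ) (c : ModP p A) :
    QPhiAux p f d l n c = qMk f d l n fun i => if i = 0 then c else 0 := by
  change (relSubmodule p f d l n).mkQ _ = (relSubmodule p f d l n).mkQ _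
  congr 1
  funext i
  refine Fin.cases ?_ (fun j => ?_) i
  · exact Pi.single_eq_same _ _
  · rw [Pi.single_eq_of_ne (Fin.succ_ne_zero j)]
    simp only [Fin.val_succ, Nat.succ_ne_zero, if_false, map_zero]

variable (hpt : IsPTorsionFree p A) (hφ : IsFrobeniusLift p φ)

/-- The sequence `(0, y_0, y_1, …)` of the twisted coordinates `y_i` of a Witt vector. -/
def shiftedCoord : ℕ → WittVector p A →+ ModP p A
  | 0 => 0
  | i + 1 => twistedCoord hpt hφ i

/-- The additive map `W(A) → Q_f(l_0, …, l_n)` given by the twisted coordinates. For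
`l = (0, 1, …, 1)` it identifies `W_n(A / f) / p` with `Q_f(l_0, …, l_n)`. -/
def wittToQ (f : A) (l : ℕ → ℕ) (n : ℕ) :
    WittVector p A →+ Q p (toModP p f) (toModP p (Delta hφ f)) l n :=
  (qMk _ _ l n).comp (AddMonoidHom.pi (shiftedCoord hpt hφ))

theorem wittToQ_apply (f : A) (l : ℕ → ℕ) (n : ℕ) (w : WittVector p A) :
    wittToQ hpt hφ f l n w = qMk _ _ l n fun i => shiftedCoord hpt hφ i w := rfl

theorem wittToQ_frobenius_teichmuller_mul (f : A) (l : ℕ → ℕ) (n : ℕ) (a : A)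
    (w : WittVector p A) :
    wittToQ hpt hφ f l n (frobenius (teichmuller p a) * w) =
      toModP p a • wittToQ hpt hφ f l n w := by
  rw [wittToQ_apply, wittToQ_apply, smul_qMk]
  congr 1
  funext i
  cases i with
  | zero => exact (mul_zero _).symm
  | succ i => exact twistedCoord_frobenius_teichmuller_mul hpt hφ i a w

theorem wittToQ_one {l : ℕ → ℕ} (hl : l 0 = 0) (f : A) (n : ℕ) :
    wittToQ hpt hφ f l n 1 = QPhiAux p _ _ l n 1 := by
  rw [eq_comm, ← sub_eq_zero, QPhiAux_eq_qMk, wittToQ_apply, ← map_sub, qMk_eq_zero]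
  refine ⟨fun i => if i = 0 then 1 else 0, fun i _ => ?_⟩
  convert dvd_zero _ using 1
  rw [Pi.sub_apply]
  match i with
  | 0 => simp [shiftedCoord, relCoord, hl]
  | 1 =>
    have := twistedCoord_zero_apply_one hpt hφ
    simp [shiftedCoord, relCoord, hl, this]
  | i + 2 =>
    have := twistedCoord_succ_apply_one hpt hφ i
    simp [shiftedCoord, relCoord, this, hp.out.ne_zero]

theorem wittToQ_surjective {l : ℕ → ℕ} (hl : l 0 = 0) (f : A) (n : ℕ) :
    Function.Surjective (wittToQ hpt hφ f l n) := by
  intro q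
  obtain ⟨x, rfl⟩ := qMk_surjective _ _ _ _ q
  obtain ⟨w, hw⟩ := exists_twistedCoord_eq hpt hφ
    (fun i => x (i + 1) + if i = 0 then x 0 ^ p else 0) n
  refine ⟨w, ?_⟩
  rw [eq_comm, ← sub_eq_zero, wittToQ_apply, ← map_sub, qMk_eq_zero]
  refine ⟨fun i => if i = 0 then x 0 else 0, fun i hi => ?_⟩
  convert dvd_zero _ using 1
  rw [Pi.sub_apply]
  match i with
  | 0 => simp [shiftedCoord, relCoord, hl]
  | 1 =>
    have := hw 0 hi
    simp [shiftedCoord, relCoord, hl, this]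
  | i + 2 =>
    have := hw (i + 1) hi
    simp [shiftedCoord, relCoord, this, hp.out.ne_zero]

/-- The surjection `W(A) → W_n(A / f) / p`. -/
def wittToWnBar (f : A) (n : ℕ) : WittVector p A →+* WnBar p (A ⧸ Ideal.span {f}) n :=
  ((toModP p).comp (truncate n)).comp (WittVector.map (Ideal.Quotient.mk (Ideal.span {f})))

theorem wittToWnBar_surjective (f : A) (n : ℕ) :
    Function.Surjective (wittToWnBar (p := p) f n) :=
  (Ideal.Quotient.mk_surjective.comp (truncate_surjective p n _)).comp
    (map_surjective _ Ideal.Quotient.mk_surjective)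

theorem wittToWnBar_eq_zero_iff {f : A} {n : ℕ} {w : WittVector p A} :
    wittToWnBar f n w = 0 ↔
      ∃ v : WittVector p A, ∀ i < n, f ∣ (w - (p : WittVector p A) * v).coeff i := by
  have key : ∀ u : WittVector p A, (∀ i < n, f ∣ u.coeff i) ↔
      truncate n (WittVector.map (Ideal.Quotient.mk (Ideal.span {f})) u) = 0 := fun u => by
    rw [← coeff_eq_zero_iff_truncate]
    refine forall_congr' fun i => forall_congr' fun _ => ?_
    rw [map_coeff, Ideal.Quotient.eq_zero_iff_mem, Ideal.mem_span_singleton]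
  simp only [key, map_sub, map_mul, map_natCast, sub_eq_zero]
  refine Ideal.Quotient.eq_zero_iff_mem.trans (Ideal.mem_span_singleton.trans ⟨?_, ?_⟩)
  · rintro ⟨y, hy⟩
    obtain ⟨v, rfl⟩ := truncate_surjective p n _ y
    obtain ⟨v, rfl⟩ := map_surjective _ Ideal.Quotient.mk_surjective v
    exact ⟨v, hy⟩
  · rintro ⟨v, hv⟩
    exact ⟨_, hv⟩

/-- Modulo `f ^ 2`, the twisted coordinates of a Witt vector with coefficients `f a_i` are given by
the relation with parameters `b_0, a_0, -a_1, a_2, …`, for any `b_0` in `(f ^ p)`. -/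
theorem exists_shiftedCoord_succ_eq {f : A} {l : ℕ → ℕ} {n : ℕ} (hl : ∀ i, 1 ≤ i → i ≤ n → l i = 1)
    {a : ℕ → A} {w : WittVector p A} (hw : ∀ i, w.coeff i = f * a i) {b : ℕ → ModP p A}
    (hb : ∀ i, b (i + 1) = (-1) ^ i * toModP p (a i)) (hb0 : toModP p f ^ p ∣ b 0) :
    ∃ c : ℕ → ModP p A, ∀ i < n, shiftedCoord hpt hφ (i + 1) w =
      relCoord p (toModP p f) (toModP p (Delta hφ f)) l b (i + 1) + toModP p f ^ 2 * c i := by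
  have h : ∀ i, ∃ c, i < n → shiftedCoord hpt hφ (i + 1) w =
      relCoord p (toModP p f) (toModP p (Delta hφ f)) l b (i + 1) + toModP p f ^ 2 * c := by
    intro i
    by_cases hi : i < n
    · cases i with
      | zero =>
        obtain ⟨c, hc⟩ : toModP p f ^ 2 ∣ b 0 ^ p :=
          (pow_dvd_pow _ hp.out.two_le).trans (hb0.trans (dvd_pow_self _ hp.out.ne_zero))
        refine ⟨c * toModP p (Delta hφ f) ^ l 0, fun _ => ?_⟩
        have h0 : shiftedCoord hpt hφ (0 + 1) w = toModP p f * toModP p (a 0) := by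
          rw [shiftedCoord, twistedCoord_of_coeff_eq_zero hpt hφ (by simp), hw, map_mul, pow_zero,
            one_mul]
        rw [h0, relCoord, hc, hb, hl _ le_rfl hi]
        ring
      | succ i =>
        obtain ⟨c, hc⟩ := exists_twistedCoord_succ_eq hpt hφ hw i
        refine ⟨c, fun _ => ?_⟩
        rw [shiftedCoord, hc, relCoord, hb, hb, hl _ (by omega) hi, hl _ (by omega) hi.le]
        ring
    · exact ⟨0, fun h => absurd h hi⟩
  choose c hc using h
  exact ⟨c, hc⟩

/-- The kernels of `W(A) → Q_f(0, 1, …, 1)` and of `W(A) → W_n(A / f) / p` agree. -/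
theorem wittToQ_eq_zero_iff {l : ℕ → ℕ} (hl0 : l 0 = 0) {f : A} {n : ℕ}
    (hl : ∀ i, 1 ≤ i → i ≤ n → l i = 1) (w : WittVector p A) :
    wittToQ hpt hφ f l n w = 0 ↔ wittToWnBar f n w = 0 := by
  constructor
  · intro h
    rw [wittToQ_apply, qMk_eq_zero] at h
    obtain ⟨b, hb⟩ := h
    -- the relation in degree `0` forces the first parameter to vanish modulo `f ^ p`
    have hb0 : toModP p f ^ p ∣ b 0 := by
      have := hb 0 (Nat.zero_le _)
      rwa [shiftedCoord, AddMonoidHom.zero_apply, relCoord, hl0, pow_zero, mul_one, zero_sub,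
        dvd_neg] at this
    have ha : ∀ i, ∃ a : A, toModP p a = (-1) ^ i * b (i + 1) := fun i =>
      Ideal.Quotient.mk_surjective _
    choose a ha using ha
    let w' : WittVector p A := WittVector.mk p fun i => f * a i
    obtain ⟨c, hc⟩ := exists_shiftedCoord_succ_eq hpt hφ hl (w := w') (fun i => rfl) (b := b)
      (fun i => by rw [ha, neg_one_pow_mul_self_mul]) hb0
    have hx : ∀ i, ∃ x, i < n → twistedCoord hpt hφ i (w - w') = toModP p f ^ 2 * x := by
      intro i
      by_cases hi : i < n
      · obtain ⟨e, he⟩ := (pow_dvd_pow (toModP p f) hp.out.two_le).trans (hb (i + 1) hi)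
        refine ⟨e - c i, fun _ => ?_⟩
        have := hc i hi
        simp only [shiftedCoord] at this he
        rw [map_sub, this, mul_sub, ← he]
        ring
      · exact ⟨0, fun h => absurd h hi⟩
    choose x hx using hx
    obtain ⟨v, hv, hvx⟩ := exists_dvd_coeff_twistedCoord_eq hpt hφ f x n
    obtain ⟨y, hy⟩ := exists_truncate_eq_of_twistedCoord_eq_zero hpt hφ n (w - w' - v) fun i hi =>
        by rw [map_sub, hx i hi, hvx i hi, sub_self]
    have hz : ∀ u : WittVector p A, (∀ i < n, f ∣ u.coeff i) → wittToWnBar f n u = 0 := fun u hu =>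
      wittToWnBar_eq_zero_iff.2 ⟨0, by simpa using hu⟩
    have h1 := hz w' fun i _ => dvd_mul_right _ _
    have h2 := hz v fun i _ => (dvd_pow_self f two_ne_zero).trans (hv i)
    have h3 := hz (w - w' - v - p * y) fun i hi => by
      rw [coeff_eq_zero_iff_truncate.2 hy i hi]
      exact dvd_zero _
    rw [map_sub, map_sub, map_sub, h1, h2, map_mul, map_natCast, natCast_modP] at h3
    simpa using h3
  · intro h
    obtain ⟨v, hv⟩ := wittToWnBar_eq_zero_iff.1 h
    have hpv : wittToQ hpt hφ f l n (p * v) = 0 := by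
      rw [← nsmul_eq_mul, map_nsmul, ← Nat.cast_smul_eq_nsmul (ModP p A), natCast_modP, zero_smul]
    obtain ⟨u, hu⟩ : ∃ u, u = w - (p : WittVector p A) * v := ⟨_, rfl⟩
    have hw : wittToQ hpt hφ f l n w = wittToQ hpt hφ f l n u := by
      rw [hu, map_sub, hpv, sub_zero]
    rw [← hu] at hv
    have hi : ∀ i, ∃ a, (init n u).coeff i = f * a := by
      intro i
      rw [init, select, coeff_mk]
      split_ifs with h
      · exact hv i h
      · exact ⟨0, (mul_zero f).symm⟩
    choose a ha using hi
    obtain ⟨c, hc⟩ := exists_shiftedCoord_succ_eq hpt hφ hl ha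
      (b := fun | 0 => 0 | i + 1 => (-1) ^ i * toModP p (a i)) (fun i => rfl) (dvd_zero _)
    rw [hw, wittToQ_apply, qMk_eq_zero]
    -- the error terms in `(f ^ 2)` are absorbed into the parameters, whose `p`-th powers do not
    -- change modulo `f ^ p`
    refine ⟨fun | 0 => 0 | i + 1 => (-1) ^ i * toModP p (a i) + toModP p f * c i, fun i hi => ?_⟩
    cases i with
    | zero => simp [shiftedCoord, relCoord]
    | succ i =>
      have ht : twistedCoord hpt hφ i (tail n u) = 0 := by
        have h0 : ∀ j < n, (tail n u).coeff j = 0 := fun j hj => by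
          rw [tail, select, coeff_mk, if_neg (not_le.2 hj)]
        rw [twistedCoord_of_coeff_eq_zero hpt hφ fun j hj => h0 j (hj.trans hi), h0 i hi, map_zero,
          mul_zero]
      have hs : shiftedCoord hpt hφ (i + 1) u = shiftedCoord hpt hφ (i + 1) (init n u) := by
        rw [shiftedCoord, ← add_zero (twistedCoord hpt hφ i (init n u)), ← ht, ← map_add,
          init_add_tail]
      rw [hs, hc i hi]
      have hf : ∀ x y : ModP p A, (x + y) ^ p = x ^ p + y ^ p := (frob p A).map_add
      cases i with
      | zero =>
        simp only [relCoord, hl _ le_rfl hi]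
        ring_nf
        exact dvd_zero _
      | succ i =>
        simp only [relCoord, hl (i + 1 + 1) (by omega) hi, hf, mul_pow (toModP p f)]
        exact ⟨c i ^ p * toModP p (Delta hφ f) ^ l (i + 1), by ring⟩

end Comparison

/-! ### Quasi-F-splitting and purity -/

section Splitting

open WittVector

theorem exists_addEquiv_of_ker_eq {G H K : Type*} [AddCommGroup G] [AddCommGroup H]
    [AddCommGroup K] (α : G →+ H) (β : G →+ K) (hα : Function.Surjective α)
    (hβ : Function.Surjective β) (h : ∀ g, α g = 0 ↔ β g = 0) :
    ∃ e : H ≃+ K, ∀ g, e (α g) = β g := by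
  have hk : α.ker = β.ker := by
    ext g
    exact h g
  let e₁ := QuotientAddGroup.quotientKerEquivOfSurjective α hα
  let e₂ := QuotientAddGroup.quotientKerEquivOfSurjective β hβ
  refine ⟨e₁.symm.trans ((QuotientAddGroup.quotientAddEquivOfEq hk).trans e₂), fun g => ?_⟩
  have : e₁.symm (α g) = (g : G ⧸ α.ker) := by
    rw [AddEquiv.symm_apply_eq]
    rfl
  rw [AddEquiv.trans_apply, this]
  rfl

variable {p : ℕ} {A : Type u} [CommRing A] {φ : A →+* A}

theorem mk_toModP_eq_zero_iff (f a : A) :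
    toModP p (Ideal.Quotient.mk (Ideal.span {f}) a) = 0 ↔
      Ideal.Quotient.mk (Ideal.span {toModP p f}) (toModP p a) = 0 := by
  rw [Ideal.Quotient.eq_zero_iff_mem, Ideal.Quotient.eq_zero_iff_mem, Ideal.mem_span_singleton,
    Ideal.mem_span_singleton]
  constructor
  · rintro ⟨b, hb⟩
    obtain ⟨b, rfl⟩ := Ideal.Quotient.mk_surjective b
    rw [← map_natCast (Ideal.Quotient.mk (Ideal.span {f})), ← map_mul,
      Ideal.Quotient.mk_eq_mk_iff_sub_mem, Ideal.mem_span_singleton] at hb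
    obtain ⟨c, hc⟩ := hb
    refine ⟨toModP p c, ?_⟩
    rw [← map_mul, ← hc, map_sub, toModP_natCast_mul, sub_zero]
  · rintro ⟨b, hb⟩
    obtain ⟨b, rfl⟩ := Ideal.Quotient.mk_surjective b
    rw [← map_mul, Ideal.Quotient.mk_eq_mk_iff_sub_mem, Ideal.mem_span_singleton] at hb
    obtain ⟨c, hc⟩ := hb
    refine ⟨Ideal.Quotient.mk _ c, ?_⟩
    have : a = f * b + p * c := by rw [← hc]; ring
    have hf : Ideal.Quotient.mk (Ideal.span {f}) f = 0 :=
      Ideal.Quotient.eq_zero_iff_mem.2 (Ideal.mem_span_singleton_self f)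
    rw [this, map_add, map_mul, map_mul, hf, zero_mul, zero_add, map_natCast]

variable [hp : Fact p.Prime]

/-- `A / f` is `n`-quasi-`F`-split if and only if `Φ_f(0, 1, …, 1)`, with `n` ones, splits. -/
theorem isNQuasiFSplit_iff_exists_leftInverse (hpt : IsPTorsionFree p A)
    (hφ : IsFrobeniusLift p φ) (f : A) {l : ℕ → ℕ} {n : ℕ} (hl0 : l 0 = 0)
    (hl : ∀ i, 1 ≤ i → i ≤ n → l i = 1) :
    IsNQuasiFSplit p (A ⧸ Ideal.span {f}) n ↔
      ∃ r, r ∘ₗ QPhi p (toModP p f) (toModP p (Delta hφ f)) l n = LinearMap.id := by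
  obtain ⟨θ, hθ⟩ := exists_addEquiv_of_ker_eq (wittToWnBar (p := p) f n).toAddMonoidHom
    (wittToQ hpt hφ f l n) (wittToWnBar_surjective f n) (wittToQ_surjective hpt hφ hl0 f n)
    fun w => (wittToQ_eq_zero_iff hpt hφ hl0 hl w).symm
  let α : A →+* ModP p (A ⧸ Ideal.span {f}) := (toModP p).comp (Ideal.Quotient.mk _)
  let β : A →+* ModP p A ⧸ Ideal.span {toModP p f ^ (l 0 + 1)} :=
    (Ideal.Quotient.mk _).comp (toModP p)
  have hα : Function.Surjective α :=
    Ideal.Quotient.mk_surjective.comp Ideal.Quotient.mk_surjective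
  have hβ : Function.Surjective β :=
    Ideal.Quotient.mk_surjective.comp Ideal.Quotient.mk_surjective
  obtain ⟨e, he⟩ := exists_addEquiv_of_ker_eq α.toAddMonoidHom β.toAddMonoidHom hα hβ fun a => by
    refine (mk_toModP_eq_zero_iff f a).trans ?_
    change _ ↔ Ideal.Quotient.mk (Ideal.span {toModP p f ^ (l 0 + 1)}) (toModP p a) = 0
    rw [hl0, zero_add, pow_one]
  change ∀ a, e (α a) = β a at he
  change ∀ w, θ (wittToWnBar f n w) = wittToQ hpt hφ f l n w at hθ
  have heα : ∀ a x, e (α a * x) = toModP p a • e x := by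
    intro a x
    obtain ⟨b, rfl⟩ := hα x
    rw [← map_mul, he, he, map_mul]
    rfl
  have hΦ : ∀ a, Phi p (A ⧸ Ideal.span {f}) n (α a) =
      wittToWnBar f n (frobenius (teichmuller p a)) := by
    intro a
    refine (Phi_apply p _ n _).trans ?_
    change _ = toModP p (truncate n (WittVector.map _ (frobenius (teichmuller p a))))
    rw [(frobenius_isPoly p).map, map_teichmuller]
  have hθΦ : ∀ a x, θ (Phi p (A ⧸ Ideal.span {f}) n (α a) * x) = toModP p a • θ x := by
    intro a x
    obtain ⟨w, rfl⟩ := wittToWnBar_surjective f n x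
    rw [hΦ, ← map_mul, hθ, hθ, wittToQ_frobenius_teichmuller_mul]
  have hQ : ∀ a, QPhi p (toModP p f) (toModP p (Delta hφ f)) l n (β a) =
      θ (Phi p (A ⧸ Ideal.span {f}) n (α a)) := by
    intro a
    rw [← mul_one (Phi p _ n (α a)), hθΦ, ← map_one (wittToWnBar f n), hθ, wittToQ_one hpt hφ hl0,
      ← map_smul, smul_eq_mul, mul_one]
    exact Submodule.liftQ_apply _ _ _
  let : Module (ModP p (A ⧸ Ideal.span {f})) (WnBar p (A ⧸ Ideal.span {f}) n) :=
    (Phi p (A ⧸ Ideal.span {f}) n).toModule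
  have hsmul : ∀ (b : ModP p (A ⧸ Ideal.span {f})) (x : WnBar p (A ⧸ Ideal.span {f}) n),
      b • x = Phi p (A ⧸ Ideal.span {f}) n b * x := fun _ _ => rfl
  constructor
  · rintro ⟨ψ, hψ⟩
    let r : Q p (toModP p f) (toModP p (Delta hφ f)) l n →ₗ[ModP p A]
        ModP p A ⧸ Ideal.span {toModP p f ^ (l 0 + 1)} :=
      { toFun := fun q => e (ψ (θ.symm q))
        map_add' := fun x y => by rw [map_add, map_add, map_add]
        map_smul' := fun c q => by
          obtain ⟨a, rfl⟩ := Ideal.Quotient.mk_surjective c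
          obtain ⟨x, rfl⟩ := θ.surjective q
          have := hθΦ a x
          rw [RingHom.id_apply, ← this, AddEquiv.symm_apply_apply, AddEquiv.symm_apply_apply,
            ← hsmul, map_smul, smul_eq_mul, heα] }
    refine ⟨r, LinearMap.ext fun x => ?_⟩
    obtain ⟨a, rfl⟩ := hβ x
    change e (ψ (θ.symm (QPhi p _ _ l n (β a)))) = β a
    rw [hQ, AddEquiv.symm_apply_apply, ← he]
    exact congrArg e (hψ _)
  · rintro ⟨r, hr⟩
    refine ⟨{ toFun := fun x => e.symm (r (θ x))
              map_add' := fun x y => by rw [map_add, map_add, map_add]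
              map_smul' := fun b x => ?_ }, fun b => ?_⟩
    · obtain ⟨a, rfl⟩ := hα b
      rw [hsmul, hθΦ, map_smul, RingHom.id_apply, AddEquiv.symm_apply_eq, smul_eq_mul, heα,
        AddEquiv.apply_symm_apply]
    · obtain ⟨a, rfl⟩ := hα b
      change e.symm (r (θ (Phi p _ n (α a)))) = α a
      rw [← hQ, AddEquiv.symm_apply_eq, he]
      exact LinearMap.congr_fun hr (β a)

theorem frob_finite (hφ : IsFrobeniusLift p φ) (hfin : φ.Finite) : (frob p A).Finite := by
  have h : (frob p A).comp (toModP p) = (toModP p).comp φ := by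
    ext a
    change toModP p a ^ p = toModP p (φ a)
    rw [← map_pow, Ideal.Quotient.mk_eq_mk_iff_sub_mem, Ideal.mem_span_singleton]
    exact hφ.dvd a
  refine RingHom.Finite.of_comp_finite (f := toModP p) ?_
  rw [h]
  exact RingHom.Finite.comp (RingHom.Finite.of_surjective _ Ideal.Quotient.mk_surjective) hfin

theorem frob_pow_finite (hφ : IsFrobeniusLift p φ) (hfin : φ.Finite) (e : ℕ) :
    (frob p A ^ e).Finite := by
  induction e with
  | zero => exact RingHom.Finite.id _
  | succ e ih =>
    rw [pow_succ]
    exact RingHom.Finite.comp ih (frob_finite hφ hfin)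

theorem finite_Q (hφ : IsFrobeniusLift p φ) (hfin : φ.Finite) (f d : ModP p A) (l : ℕ → ℕ)
    (n : ℕ) : Module.Finite (ModP p A) (Q p f d l n) := by
  have h : ∀ i : Fin (n + 1),
      Module.Finite (ModP p A) (FPush p A i (ModP p A ⧸ Ideal.span {f ^ p})) := by
    intro i
    have h0 : Module.Finite (ModP p A) (FPush p A i (ModP p A)) :=
      (frob_pow_finite hφ hfin i :)
    let g : FPush p A i (ModP p A) →ₗ[ModP p A] FPush p A i (ModP p A ⧸ Ideal.span {f ^ p}) :=
      { toFun := fun x => Ideal.Quotient.mk (Ideal.span {f ^ p}) x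
        map_add' := fun _ _ => rfl
        map_smul' := fun _ _ => rfl }
    exact Module.Finite.of_surjective g
      (Ideal.Quotient.mk_surjective (I := Ideal.span {f ^ p}))
  infer_instance

/-- `A / f` is `n`-quasi-`F`-split if and only if `Φ_f(0, 1, …, 1)`, with `n` ones, is pure. -/
theorem isNQuasiFSplit_iff_isPure [IsNoetherianRing A] (hpt : IsPTorsionFree p A)
    (hφ : IsFrobeniusLift p φ) (hfin : φ.Finite) (f : A) {l : ℕ → ℕ} {n : ℕ} (hl0 : l 0 = 0)
    (hl : ∀ i, 1 ≤ i → i ≤ n → l i = 1) :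
    IsNQuasiFSplit p (A ⧸ Ideal.span {f}) n ↔
      IsPure (QPhi p (toModP p f) (toModP p (Delta hφ f)) l n) := by
  rw [isNQuasiFSplit_iff_exists_leftInverse hpt hφ f hl0 hl]
  constructor
  · rintro ⟨r, hr⟩
    exact IsPure.of_leftInverse hr
  · intro h
    have := finite_Q hφ hfin (toModP p f) (toModP p (Delta hφ f)) l n
    refine h.exists_leftInverse (e := Ideal.Quotient.mk _ 1) fun z => ?_
    obtain ⟨r, rfl⟩ := Ideal.Quotient.mk_surjective z
    exact ⟨r, by
      change Ideal.Quotient.mk _ (r * 1) = _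
      rw [mul_one]⟩

/-- If `l'` continues `l_0, …, l_{n - 1}`, then extension by zero is a map
`Q_f(l_0, …, l_n) → Q_f(l'_0, …, l'_{n'})` under `Φ_f`, provided that the relation attached to the
last parameter is preserved; so purity passes from the target to the source. -/
theorem IsPure.QPhi_of_le {f d : ModP p A} {l l' : ℕ → ℕ} {n n' : ℕ} (hn : n ≤ n') (h0 : 0 < n)
    (hlt : ∀ i < n, l' i = l i) (hle : l' n ≤ l n) (hlt' : n < n' → l' n < l n)
    (h : IsPure (QPhi p f d l' n')) : IsPure (QPhi p f d l n) := by
  let E : QAmbient p f n →ₗ[ModP p A] QAmbient p f n' :=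
    { toFun := fun x i => if hi : (i : ℕ) < n + 1 then x ⟨i, hi⟩ else 0
      map_add' := fun x y => by
        funext i
        rw [Pi.add_apply]
        split_ifs
        · rfl
        · rw [add_zero]
      map_smul' := fun c x => by
        funext i
        rw [Pi.smul_apply]
        split_ifs
        · rfl
        · rw [smul_zero] }
  have hEy : ∀ y : ℕ → ModP p A,
      E (fun i : Fin (n + 1) => FPush.of p A i _ (Ideal.Quotient.mk (Ideal.span {f ^ p}) (y i))) =
      fun i : Fin (n' + 1) => FPush.of p A i _ (Ideal.Quotient.mk (Ideal.span {f ^ p})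
        (if (i : ℕ) < n + 1 then y i else 0)) := by
    intro y
    funext i
    by_cases hi : (i : ℕ) < n + 1
    · exact (dif_pos hi).trans (by rw [if_pos hi])
    · exact (dif_neg hi).trans (by rw [if_neg hi, map_zero, map_zero])
  have hE : relSubmodule p f d l n ≤ (relSubmodule p f d l' n').comap E := by
    rintro x ⟨a, ha⟩
    rw [Submodule.mem_comap, funext ha, hEy]
    refine (mk_mem_relSubmodule fun i => if i < n + 1 then relCoord p f d l a i else 0).2 ?_
    -- the parameter `a_n` becomes `a_n f ^ k`; if a further coordinate follows, then `k` is
    -- positive and its entry `(a_n f ^ k) ^ p` vanishes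
    obtain ⟨k, hk⟩ := Nat.exists_eq_add_of_le hle
    refine ⟨fun i => if i < n then a i else if i = n then a n * f ^ k else 0, fun i hi => ?_⟩
    rcases lt_trichotomy i n with h | rfl | h
    · rw [if_pos (h.trans n.lt_succ_self)]
      convert dvd_zero _ using 1
      cases i with
      | zero => simp only [relCoord, if_pos h, hlt 0 h, sub_self]
      | succ i => simp only [relCoord, if_pos h, if_pos (i.lt_succ_self.trans h), hlt _ h,
          hlt _ (i.lt_succ_self.trans h), sub_self]
    · rw [if_pos i.lt_succ_self]
      convert dvd_zero _ using 1
      cases i with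
      | zero => exact absurd h0 (lt_irrefl 0)
      | succ i =>
        simp only [relCoord, lt_irrefl, if_false, if_true, if_pos i.lt_succ_self,
          hlt _ i.lt_succ_self, hk, pow_add]
        ring
    · rw [if_neg (by omega), zero_sub, dvd_neg]
      cases i with
      | zero => exact absurd h (Nat.not_lt_zero n)
      | succ i =>
        have h1 : ¬ i + 1 < n := by omega
        have h2 : i + 1 ≠ n := by omega
        simp only [relCoord, if_neg h1, if_neg h2, zero_mul, add_zero, dvd_neg]
        rcases (Nat.lt_succ_iff.1 h).eq_or_lt with rfl | h3
        · have hk0 : k ≠ 0 := by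
            rintro rfl
            have := hlt' (by omega)
            omega
          rw [if_neg (lt_irrefl n), if_pos rfl, mul_pow, ← pow_mul]
          exact (((pow_dvd_pow f (Nat.le_mul_of_pos_left p (Nat.pos_of_ne_zero hk0))).mul_left
            _)).mul_right _
        · rw [if_neg (by omega), if_neg (by omega), zero_pow hp.out.ne_zero, zero_mul]
          exact dvd_zero _
  let g : Q p f d l n →ₗ[ModP p A] Q p f d l' n' :=
    (relSubmodule p f d l n).mapQ (relSubmodule p f d l' n') E hE
  have hI : Ideal.span {f ^ (l 0 + 1)} = Ideal.span {f ^ (l' 0 + 1)} := by rw [hlt 0 h0]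
  have hg : g ∘ₗ QPhi p f d l n =
      QPhi p f d l' n' ∘ₗ (Submodule.quotEquivOfEq _ _ hI).toLinearMap := by
    refine LinearMap.ext fun z => ?_
    obtain ⟨c, rfl⟩ := Ideal.Quotient.mk_surjective z
    change g (QPhiAux p f d l n c) = QPhiAux p f d l' n' c
    rw [QPhiAux_eq_qMk, QPhiAux_eq_qMk]
    refine (congrArg (relSubmodule p f d l' n').mkQ (hEy fun i => if i = 0 then c else 0)).trans ?_
    change qMk f d l' n' (fun i => if i < n + 1 then if i = 0 then c else 0 else 0) = _
    congr 1
    funext i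
    split_ifs <;> first | rfl | omega
  refine IsPure.of_comp (k := g) ?_
  rw [hg]
  exact h.comp_equiv _

end Splitting

/-! ### The splitting-order sequence -/

section SplittingOrder

variable {p : ℕ} [hp : Fact p.Prime] {A : Type u} [CommRing A] {φ : A →+* A}

/-- The sequence `0, 1, …, 1, t` with last term `t` in degree `n`. -/
def onesThen (n t : ℕ) (i : ℕ) : ℕ := if i = 0 then 0 else if i < n then 1 else t

theorem onesThen_zero (n t : ℕ) : onesThen n t 0 = 0 := if_pos rfl

theorem onesThen_of_lt {n i : ℕ} (t : ℕ) (h0 : 1 ≤ i) (h : i < n) : onesThen n t i = 1 := by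
  rw [onesThen, if_neg (by omega), if_pos h]

theorem onesThen_self {n : ℕ} (t : ℕ) (h0 : 1 ≤ n) : onesThen n t n = t := by
  rw [onesThen, if_neg (by omega), if_neg (lt_irrefl n)]

theorem onesThen_one {n i : ℕ} (h0 : 1 ≤ i) : onesThen n 1 i = 1 := by
  rw [onesThen, if_neg (by omega), ite_self]

theorem splittingOrder_zero (hφ : IsFrobeniusLift p φ) (f : A) : splittingOrder hφ f 0 = 0 := by
  rw [splittingOrder, if_pos rfl]

/-- The set whose supremum is `s_n`, when `s_1 = ⋯ = s_{n - 1} = 1`. -/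
def notPureSet (hφ : IsFrobeniusLift p φ) (f : A) (n : ℕ) : Set ℕ :=
  {t | t ≤ p ∧ ¬ IsPure (QPhi p (toModP p f) (toModP p (Delta hφ f)) (onesThen n t) n)}

theorem splittingOrder_eq_sSup (hφ : IsFrobeniusLift p φ) (f : A) {n : ℕ} (hn : 1 ≤ n)
    (h : ∀ i, 1 ≤ i → i < n → splittingOrder hφ f i = 1) :
    splittingOrder hφ f n = sSup (notPureSet hφ f n) := by
  have hlt : ∀ i < n, splittingOrder hφ f i = if i = 0 then 0 else 1 := by
    intro i hi
    split_ifs with h0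
    · rw [h0, splittingOrder_zero]
    · exact h i (by omega) hi
  have hne : ¬ ∃ i : Fin n, splittingOrder hφ f i = p := by
    rintro ⟨i, hi⟩
    rw [hlt i i.2] at hi
    have := hp.out.two_le
    split_ifs at hi <;> omega
  rw [splittingOrder, if_neg (by omega), if_neg hne]
  have hl : ∀ t, (fun i => if _h : i < n then splittingOrder hφ f i else t) = onesThen n t := by
    intro t
    funext i
    rw [onesThen]
    split_ifs with h1 h2 h2
    · rw [h2, splittingOrder_zero]
    · rw [hlt i h1, if_neg h2]
    · omega
    · rfl
  have hcongr : ∀ l l' : ℕ → ℕ, l = l' →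
      (IsPure (QPhi p (toModP p f) (toModP p (Delta hφ f)) l n) ↔
        IsPure (QPhi p (toModP p f) (toModP p (Delta hφ f)) l' n)) := by
    rintro l _ rfl
    rfl
  refine congrArg sSup (Set.ext fun t => and_congr_right fun _ => not_congr ?_)
  exact hcongr _ _ (hl t)

theorem bddAbove_notPureSet (hφ : IsFrobeniusLift p φ) (f : A) (n : ℕ) :
    BddAbove (notPureSet hφ f n) :=
  ⟨p, fun _ ht => ht.1⟩

variable [IsNoetherianRing A]

theorem one_mem_notPureSet (hpt : IsPTorsionFree p A) (hφ : IsFrobeniusLift p φ)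
    (hfin : φ.Finite) (f : A) (n : ℕ) :
    1 ∈ notPureSet hφ f n ↔ ¬ IsNQuasiFSplit p (A ⧸ Ideal.span {f}) n := by
  rw [isNQuasiFSplit_iff_isPure hpt hφ hfin f (onesThen_zero n 1) fun i hi _ => onesThen_one hi]
  exact and_iff_right hp.out.one_lt.le

theorem not_mem_notPureSet (hpt : IsPTorsionFree p A) (hφ : IsFrobeniusLift p φ)
    (hfin : φ.Finite) {f : A} {n h t : ℕ} (hf : IsNQuasiFSplit p (A ⧸ Ideal.span {f}) h)
    (hn : 1 ≤ n) (hnh : n ≤ h) (ht : 1 ≤ t) (htn : n < h → 1 < t) : t ∉ notPureSet hφ f n := by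
  rw [isNQuasiFSplit_iff_isPure hpt hφ hfin f (onesThen_zero h 1) fun i hi _ => onesThen_one hi]
    at hf
  refine fun hm => hm.2 (hf.QPhi_of_le hnh hn (fun i hi => ?_) ?_ fun hlt => ?_)
  · rcases Nat.eq_zero_or_pos i with rfl | h0
    · rw [onesThen_zero, onesThen_zero]
    · rw [onesThen_one h0, onesThen_of_lt t h0 hi]
  · rwa [onesThen_one hn, onesThen_self t hn]
  · rw [onesThen_one hn, onesThen_self t hn]
    exact htn hlt

end SplittingOrder

end QFSplit

end

theorem proposition3p7 {p : ℕ} [Fact p.Prime] {A : Type*} [CommRing A] [IsLocalRing A]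
    [IsNoetherianRing A] (hpm : (p : A) ∈ IsLocalRing.maximalIdeal A)
    (hpt : QFSplit.IsPTorsionFree p A)
    {φ : A →+* A} (hφ : QFSplit.IsFrobeniusLift p φ) (hfin : φ.Finite)
    (f : A) (h : ℕ) (hh : 1 ≤ h) :
    QFSplit.IsQuasiFSplitOfHeight p (A ⧸ Ideal.span {f}) h ↔
      (∀ i : ℕ, 1 ≤ i → i < h → QFSplit.splittingOrder hφ f i = 1) ∧
        QFSplit.splittingOrder hφ f h = 0 := by
  constructor
  · rintro ⟨⟨_, hs⟩, hmin⟩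
    have h1 : ∀ i : ℕ, 1 ≤ i → i < h → QFSplit.splittingOrder hφ f i = 1 := by
      intro i
      induction i using Nat.strong_induction_on with
      | _ i ih =>
        intro hi hih
        rw [QFSplit.splittingOrder_eq_sSup hφ f hi fun j hj hji => ih j hji hj (hji.trans hih)]
        refine IsGreatest.csSup_eq ⟨(QFSplit.one_mem_notPureSet hpt hφ hfin f i).2 fun hsi =>
          absurd (hmin ⟨hi, hsi⟩) (not_le.2 hih), fun t ht => ?_⟩
        by_contra! hlt
        exact QFSplit.not_mem_notPureSet hpt hφ hfin hs hi hih.le hlt.le (fun _ => hlt) ht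
    refine ⟨h1, ?_⟩
    rw [QFSplit.splittingOrder_eq_sSup hφ f hh h1, ← Nat.le_zero]
    refine csSup_le' fun t ht => ?_
    by_contra! hlt
    exact QFSplit.not_mem_notPureSet hpt hφ hfin hs hh le_rfl hlt
      (fun hlt' => absurd hlt' h.lt_irrefl) ht
  · rintro ⟨h1, h0⟩
    refine ⟨⟨hh, ?_⟩, fun n ⟨hn, hs⟩ => ?_⟩
    · by_contra hs
      rw [QFSplit.splittingOrder_eq_sSup hφ f hh h1] at h0
      have := le_csSup (QFSplit.bddAbove_notPureSet hφ f h)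
        ((QFSplit.one_mem_notPureSet hpt hφ hfin f h).2 hs)
      omega
    · by_contra! hlt
      have hn1 := h1 n hn hlt
      rw [QFSplit.splittingOrder_eq_sSup hφ f hn fun i hi hin => h1 i hi (hin.trans hlt)] at hn1
      have hne : (QFSplit.notPureSet hφ f n).Nonempty := by
        rw [Set.nonempty_iff_ne_empty]
        intro he
        rw [he, csSup_empty] at hn1
        exact absurd hn1 (by decide)
      have hmem := Nat.sSup_mem hne (QFSplit.bddAbove_notPureSet hφ f n)
      rw [hn1] at hmem
      exact (QFSplit.one_mem_notPureSet hpt hφ hfin f n).1 hmem hs
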